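/- All graphs are finite and simple. For a graph $G$ of order $n$, let $Q(G)=D(G)+A(G)$ be its signless Laplacian matrix (degree matrix plus adjacency matrix), let $q_{\min}(G)$ be the least eigenvalue of $Q(G)$, and let $\gamma(G)$ be the domination number of $G$, i.e. the minimum cardinality of a set $S$ of vertices such that every vertex outside $S$ has a neighbour in $S$. A graph is unicyclic if it is connected and contains exactly one cycle. Let $g\ge 3$ be odd and $n>g$. For $1\le k\le n-g$, let $U_n^k(g)$ be the graph of order $n$ obtained from a cycle $C_g$, a path $P_l$ on $l=n+1-g-k$ vertices and a star $S_{1,k}$ with $k$ leaves by identifying one end of the path with a vertex of the cycle and the other end with the centre of the star (if $l=1$, the centre of the star is identified with a vertex of the cycle). Put $\gamma_g=\gamma(U_n^1(g))$. **Theorem.** Let $\gamma$ be an integer with $\lceil g/3\rceil\le\gamma\le\gamma_g$. Then there is a $k\in\{1,\dots,n-g\}$ with $\gamma(U_n^k(g))=\gamma$; let $V_n^\gamma(g)=U_n^k(g)$ for the smallest such $k$. Among all unicyclic graphs of order $n$ with girth $g$ and domination number $\gamma$, the graph $V_n^\gamma(g)$ is, up to isomorphism, the unique one minimizing $q_{\min}$.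 That is, $V_n^\gamma(g)$ belongs to this class, and every graph $G$ in this class satisfies $q_{\min}(G)\ge q_{\min}(V_n^\gamma(g))$, with equality if and only if $G\cong V_n^\gamma(g)$. -/

import Mathlib

/-- The signless Laplacian matrix `Q(G) = D(G) + A(G)`. -/
noncomputable def signlessLaplacian {V : Type*} [Fintype V] (G : SimpleGraph V) :
    Matrix V V ℝ :=
  open Classical in G.degMatrix ℝ + G.adjMatrix ℝ

/-- The least eigenvalue of the (real symmetric) signless Laplacian matrix of `G`. -/
noncomputable def qMin {V : Type*} [Fintype V] (G : SimpleGraph V) : ℝ :=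
  open Classical in sInf (spectrum ℝ (signlessLaplacian G))

/-- `S` is a dominating set of `G`: every vertex outside `S` has a neighbour in `S`. -/
def IsDominatingSet {V : Type*} (G : SimpleGraph V) (S : Finset V) : Prop :=
  ∀ v, v ∉ S → ∃ u ∈ S, G.Adj v u

/-- The minimum cardinality of a dominating set of `G`. -/
noncomputable def dominationNumber {V : Type*} (G : SimpleGraph V) : ℕ :=
  sInf {m : ℕ | ∃ S : Finset V, IsDominatingSet G S ∧ S.card = m}

/-- `G` is connected and exactly one of its subgraphs is a cycle. -/
def IsUnicyclic {V : Type*} (G : SimpleGraph V) : Prop :=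
  G.Connected ∧
    ∃! H : G.Subgraph, ∃ (v : V) (c : G.Walk v v), c.IsCycle ∧ c.toSubgraph = H

/-- The class of unicyclic graphs of order `n` with odd girth `g` and domination number `γ`. -/
def IsUnicyclicOfType (n g γ : ℕ) {V : Type*} [Fintype V] (G : SimpleGraph V) : Prop :=
  Fintype.card V = n ∧ IsUnicyclic G ∧ Odd G.girth ∧ G.girth = g ∧ dominationNumber G = γ

/-- The graph `U_n^k(g)` (for `3 ≤ g`, `1 ≤ k`, `g + k ≤ n`) on the vertices `0, …, n - 1`.
The cycle has the vertices `0, …, g - 1`; the connecting path, on `l = n + 1 - g - k` vertices,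
has the vertices `g - 1, g, …, n - k - 1`; its last vertex `n - k - 1` is the centre of the star,
whose `k` leaves are `n - k, …, n - 1`. The three clauses below give the edges `{i, i + 1}` with
`i + 1 ≤ n - k - 1` (of the cycle and of the path), the edge `{0, g - 1}` closing the cycle, and
the edges of the star. -/
def graphU (n k g : ℕ) : SimpleGraph (Fin n) :=
  SimpleGraph.fromRel fun i j : Fin n =>
    ((j : ℕ) = i + 1 ∧ (j : ℕ) + k < n) ∨
    ((i : ℕ) = 0 ∧ (j : ℕ) + 1 = g) ∨
    ((i : ℕ) + k + 1 = n ∧ n ≤ (j : ℕ) + k)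

/-- `γ_g`, the domination number of `U_n^1(g)`. -/
noncomputable def gammaMax (n g : ℕ) : ℕ :=
  dominationNumber (graphU n 1 g)

/-- The numbers `k` for which `U_n^k(g)` is defined and has domination number `γ`. -/
def leafCounts (n g γ : ℕ) : Set ℕ :=
  {k : ℕ | 1 ≤ k ∧ g + k ≤ n ∧ dominationNumber (graphU n k g) = γ}

/-- `V_n^γ(g)`: the graph `U_n^k(g)` with domination number `γ` whose `k` is minimum. -/
noncomputable def graphV (n γ g : ℕ) : SimpleGraph (Fin n) :=
  graphU n (sInf (leafCounts n g γ)) g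

/-!
The proof compares Rayleigh quotients. Two facts about a unicyclic graph `G` of order `n`, odd girth
`g` and domination number `γ` are combined, where `D` is the largest distance of a vertex from the
cycle.

*The depth is bounded by the domination number.* `G` contains the cycle with a pendant path of
length `D`. Projecting a dominating set along the attached trees onto this subgraph shows that
`dominationNumber (graphU n k g) ≤ γ` for `k = n + 1 - g - D`
(`IsCycleWithTrees.dominationNumber_graphU_le`). As a function of `k`, the domination number of
`graphU n k g` drops by at most one per step, so it takes the value `γ` for some `j ≤ k`
(`exists_dominationNumber_graphU_eq`). Hence the smallest such number `k₀` satisfies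
`D ≤ n + 1 - g - k₀`: the trees of `G` are not deeper than that of the graph `U = graphU n k₀ g`.

*Among the graphs of bounded depth, `U` has the smallest least eigenvalue*
(`IsCycleWithTrees.qMin_graphU_le`). Let `x` be an eigenvector of `G` for `q = qMin G`. One has
`q < 1` without loss of generality, because `qMin U < 1`, and `0 < q`, because the cycle is odd. Let
`w` be a vertex of maximum modulus among those of depth less than `D`. Keep the cycle and the path
from the cycle to `w`, and replace everything else by a path starting at `w` and ending in a star.
A vertex `z` with the parent `p` contributes `(x z + x p)² - q (x z)²` to `x ⬝ (Q - q) x`. For fixed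
`x p`, this is at least `-q / (1 - q) * (x p)²`, with equality for `x z = -x p / (1 - q)`, and hence
at least `-q / (1 - q) * (x w)²`. The test vector on `U` that has the modulus `|x w| / (1 - q)` at
all new vertices, with alternating signs along the path, makes the contribution of each new vertex
at most this bound. So `y ⬝ (Q(U) - q) y ≤ x ⬝ (Q(G) - q) x = 0`. In the case of equality `w` is as
deep as the centre of the star, each vertex off the core is a leaf whose parent has the modulus of
`w`, and comparing the eigenvalue equations of `x` and `y` at that parent shows that the parent is
`w` (`parent_eq_of_qMin_eq`); thus `G` is isomorphic to `U`.

To make this computable, a unicyclic graph is written as a tree, given by its parent function,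
together with one additional edge (`IsTreePlusEdge`); the bilinear form of the signless Laplacian is
then a sum over the vertices. That a unicyclic graph has this form follows by counting edges
(`IsUnicyclic.exists_isCycleWithTrees`).
-/

/-! ### The least eigenvalue as a minimum of Rayleigh quotients -/

open Matrix in
theorem isHermitian_signlessLaplacian {V : Type*} [Fintype V] (G : SimpleGraph V) :
    (signlessLaplacian G).IsHermitian := by
  classical
  unfold signlessLaplacian
  refine IsHermitian.add ?_ ?_
  · simp [SimpleGraph.degMatrix, IsHermitian, conjTranspose, diagonal_transpose]
  · convert G.isHermitian_adjMatrix ℝ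

open Matrix in
/-- The least eigenvalue is attained, because the spectrum is finite and nonempty. -/
theorem qMin_mem_spectrum {V : Type*} [Fintype V] [DecidableEq V] [Nonempty V]
    (G : SimpleGraph V) : qMin G ∈ spectrum ℝ (signlessLaplacian G) := by
  have h := (isHermitian_signlessLaplacian G).spectrum_real_eq_range_eigenvalues
  have h2 : sInf (spectrum ℝ (signlessLaplacian G)) ∈ spectrum ℝ (signlessLaplacian G) := by
    apply Set.Nonempty.csInf_mem
    · rw [h]; exact Set.range_nonempty _
    · rw [h]; exact Set.finite_range _
  unfold qMin
  convert h2

open Matrix in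
theorem exists_mulVec_eq_qMin_smul {V : Type*} [Fintype V] [Nonempty V] (G : SimpleGraph V) :
    ∃ x : V → ℝ, x ≠ 0 ∧ signlessLaplacian G *ᵥ x = qMin G • x := by
  classical
  have h := qMin_mem_spectrum G
  rw [← spectrum_toLin', ← Module.End.hasEigenvalue_iff_mem_spectrum] at h
  obtain ⟨x, hx⟩ := h.exists_hasEigenvector
  exact ⟨x, hx.2, by simpa using hx.apply_eq_smul⟩

open Matrix in
theorem qMin_le_of_mem_spectrum {V : Type*} [Fintype V] [DecidableEq V] (G : SimpleGraph V)
    {a : ℝ} (ha : a ∈ spectrum ℝ (signlessLaplacian G)) : qMin G ≤ a := by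
  have h := (isHermitian_signlessLaplacian G).spectrum_real_eq_range_eigenvalues
  have h2 : sInf (spectrum ℝ (signlessLaplacian G)) ≤ a := by
    refine csInf_le ?_ ha
    rw [h]
    exact (Set.finite_range _).bddBelow
  unfold qMin
  convert h2

open Matrix in
theorem posSemidef_signlessLaplacian_sub {V : Type*} [Fintype V] [DecidableEq V]
    (G : SimpleGraph V) : (signlessLaplacian G - qMin G • (1 : Matrix V V ℝ)).PosSemidef := by
  rw [posSemidef_iff_isHermitian_and_spectrum_nonneg]
  refine ⟨(isHermitian_signlessLaplacian G).sub (by simp [IsHermitian]), ?_⟩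
  intro a ha
  have h2 : a + qMin G ∈ spectrum ℝ (signlessLaplacian G) := by
    rw [← Algebra.algebraMap_eq_smul_one, ← spectrum.sub_singleton_eq] at ha
    obtain ⟨b, hb, c, hc, rfl⟩ := ha
    obtain rfl : c = qMin G := hc
    simpa using hb
  simpa using qMin_le_of_mem_spectrum G h2

open Matrix in
theorem qMin_mul_dotProduct_le {V : Type*} [Fintype V] (G : SimpleGraph V) (x : V → ℝ) :
    qMin G * (x ⬝ᵥ x) ≤ x ⬝ᵥ (signlessLaplacian G *ᵥ x) := by
  classical
  have h := (posSemidef_signlessLaplacian_sub G).dotProduct_mulVec_nonneg x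
  simp only [sub_mulVec, smul_mulVec, one_mulVec, dotProduct_sub, dotProduct_smul, star_trivial,
    smul_eq_mul] at h
  linarith

open Matrix in
/-- A vector whose Rayleigh quotient is the least eigenvalue is an eigenvector. -/
theorem mulVec_eq_of_dotProduct_eq {V : Type*} [Fintype V] (G : SimpleGraph V) (x : V → ℝ)
    (hx : x ⬝ᵥ (signlessLaplacian G *ᵥ x) = qMin G * (x ⬝ᵥ x)) :
    signlessLaplacian G *ᵥ x = qMin G • x := by
  classical
  have h := ((posSemidef_signlessLaplacian_sub G).dotProduct_mulVec_zero_iff x).1 (by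
    simp only [sub_mulVec, smul_mulVec, one_mulVec, dotProduct_sub, dotProduct_smul, star_trivial,
      smul_eq_mul]
    linarith)
  rw [sub_mulVec, smul_mulVec, one_mulVec] at h
  exact sub_eq_zero.1 h

open Matrix in
theorem qMin_le_of_dotProduct_le {V : Type*} [Fintype V] {G : SimpleGraph V} {x : V → ℝ} {q : ℝ}
    (hx : x ≠ 0) (h : x ⬝ᵥ (signlessLaplacian G *ᵥ x) ≤ q * (x ⬝ᵥ x)) : qMin G ≤ q := by
  have h1 : 0 < x ⬝ᵥ x := by
    have := dotProduct_star_self_pos_iff.2 hx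
    simpa using this
  exact le_of_mul_le_mul_right ((qMin_mul_dotProduct_le G x).trans h) h1

open Matrix Classical in
theorem dotProduct_signlessLaplacian_mulVec {V : Type*} [Fintype V] (G : SimpleGraph V)
    (y x : V → ℝ) : y ⬝ᵥ (signlessLaplacian G *ᵥ x) =
      ∑ u, ∑ v, if G.Adj u v then y u * (x u + x v) else 0 := by
  simp only [dotProduct, signlessLaplacian, add_mulVec, Pi.add_apply]
  refine Finset.sum_congr rfl fun u _ => ?_
  rw [SimpleGraph.degMatrix, mulVec_diagonal, SimpleGraph.adjMatrix_mulVec_apply,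
    ← Finset.sum_filter, ← Finset.mul_sum, Finset.sum_add_distrib, ← G.neighborFinset_eq_filter]
  simp

theorem dotProduct_mulVec_comp_iso {V W : Type*} [Fintype V] [Fintype W] {G : SimpleGraph V}
    {H : SimpleGraph W} (f : G ≃g H) (x : W → ℝ) :
    (x ∘ f) ⬝ᵥ (signlessLaplacian G).mulVec (x ∘ f) = x ⬝ᵥ (signlessLaplacian H).mulVec x := by
  classical
  rw [dotProduct_signlessLaplacian_mulVec, dotProduct_signlessLaplacian_mulVec,
    ← Equiv.sum_comp f.toEquiv]
  refine Finset.sum_congr rfl fun u _ => ?_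
  rw [← Equiv.sum_comp f.toEquiv]
  refine Finset.sum_congr rfl fun v _ => ?_
  have h : H.Adj (f u) (f v) ↔ G.Adj u v := f.map_rel_iff
  simp [h]

theorem dotProduct_comp_iso {V W : Type*} [Fintype V] [Fintype W] {G : SimpleGraph V}
    {H : SimpleGraph W} (f : G ≃g H) (x : W → ℝ) : (x ∘ f) ⬝ᵥ (x ∘ f) = x ⬝ᵥ x :=
  Equiv.sum_comp f.toEquiv fun v => x v * x v

theorem comp_iso_ne_zero {V W : Type*} {G : SimpleGraph V} {H : SimpleGraph W} (f : G ≃g H)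
    {x : W → ℝ} (hx : x ≠ 0) : x ∘ f ≠ 0 := fun h => hx <| funext fun v => by
  simpa using congrFun h (f.symm v)

theorem qMin_le_of_iso {V W : Type*} [Fintype V] [Fintype W] [Nonempty W] {G : SimpleGraph V}
    {H : SimpleGraph W} (f : G ≃g H) : qMin G ≤ qMin H := by
  obtain ⟨x, hx, hxq⟩ := exists_mulVec_eq_qMin_smul H
  refine qMin_le_of_dotProduct_le (comp_iso_ne_zero f hx) (le_of_eq ?_)
  rw [dotProduct_mulVec_comp_iso, dotProduct_comp_iso, hxq, dotProduct_smul, smul_eq_mul]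

theorem qMin_congr {V W : Type*} [Fintype V] [Fintype W] [Nonempty W] {G : SimpleGraph V}
    {H : SimpleGraph W} (f : G ≃g H) : qMin G = qMin H :=
  have : Nonempty V := ‹Nonempty W›.map f.symm
  le_antisymm (qMin_le_of_iso f) (qMin_le_of_iso f.symm)

theorem mulVec_comp_iso {V W : Type*} [Fintype V] [Fintype W] [Nonempty W] {G : SimpleGraph V}
    {H : SimpleGraph W} (f : G ≃g H) {x : W → ℝ}
    (hx : (signlessLaplacian H).mulVec x = qMin H • x) :
    (signlessLaplacian G).mulVec (x ∘ f) = qMin G • (x ∘ f) := by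
  refine mulVec_eq_of_dotProduct_eq G (x ∘ f) ?_
  rw [dotProduct_mulVec_comp_iso, dotProduct_comp_iso, hx, dotProduct_smul, smul_eq_mul,
    qMin_congr f]

/-! ### Trees with one additional edge -/

/-- `G` is the tree with root `r` in which the parent of `v ≠ r` is `P v`, together with the
additional edge `{r, t}`. The function `h` witnesses that passing to the parent terminates; the
value `P r` is irrelevant. -/
structure IsTreePlusEdge {V : Type*} (G : SimpleGraph V) (P : V → V) (h : V → ℕ) (r t : V) :
    Prop where
  height_lt : ∀ v, v ≠ r → h (P v) < h v
  ne_root : t ≠ r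
  parent_ne_root : P t ≠ r
  adj_iff : ∀ u v, G.Adj u v ↔
    (u ≠ r ∧ P u = v) ∨ (v ≠ r ∧ P v = u) ∨ (u = r ∧ v = t) ∨ (u = t ∧ v = r)

/-- The bilinear form of the signless Laplacian, as a sum over the edges. -/
theorem IsTreePlusEdge.dotProduct_mulVec {V : Type*} [Fintype V] [DecidableEq V]
    {G : SimpleGraph V} {P : V → V} {h : V → ℕ} {r t : V} (hG : IsTreePlusEdge G P h r t)
    (y x : V → ℝ) : y ⬝ᵥ (signlessLaplacian G).mulVec x =
      (∑ v, if v ≠ r then (y v + y (P v)) * (x v + x (P v)) else 0) +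
        (y r + y t) * (x r + x t) := by
  classical
  rw [dotProduct_signlessLaplacian_mulVec]
  have key : ∀ u v, (if G.Adj u v then y u * (x u + x v) else 0) =
      (if P u = v then (if u ≠ r then y u * (x u + x v) else 0) else 0) +
      (if P v = u then (if v ≠ r then y u * (x u + x v) else 0) else 0) +
      (if v = t then (if u = r then y u * (x u + x v) else 0) else 0) +
      (if v = r then (if u = t then y u * (x u + x v) else 0) else 0) := by
    intro u v
    have h1 := hG.height_lt u
    have h2 := hG.height_lt v
    have h3 := hG.ne_root
    have h4 := hG.parent_ne_root
    rw [hG.adj_iff]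
    by_cases a1 : P u = v <;> by_cases a2 : P v = u <;> by_cases a3 : u = r <;>
      by_cases a4 : v = r <;> by_cases a5 : u = t <;> by_cases a6 : v = t <;>
      simp_all <;> grind
  simp only [key, Finset.sum_add_distrib]
  have e1 : ∀ u, (∑ v, if P u = v then (if u ≠ r then y u * (x u + x v) else 0) else 0) =
      if u ≠ r then y u * (x u + x (P u)) else 0 := by
    intro u; simp
  have e3 : ∀ u, (∑ v, if v = t then (if u = r then y u * (x u + x v) else 0) else 0) =
      if u = r then y u * (x u + x t) else 0 := by
    intro u; simp
  have e4 : ∀ u, (∑ v, if v = r then (if u = t then y u * (x u + x v) else 0) else 0) =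
      if u = t then y u * (x u + x r) else 0 := by
    intro u; simp
  rw [Finset.sum_comm (f := fun u v => if P v = u then (if v ≠ r then y u * (x u + x v) else 0)
    else 0)]
  have e2 : ∀ v, (∑ u, if P v = u then (if v ≠ r then y u * (x u + x v) else 0) else 0) =
      if v ≠ r then y (P v) * (x (P v) + x v) else 0 := by
    intro v; simp
  simp only [e1, e2, e3, e4]
  simp only [Finset.sum_ite_eq', Finset.mem_univ, if_true]
  rw [← Finset.sum_add_distrib, add_assoc]
  congr 1
  · refine Finset.sum_congr rfl fun v _ => ?_
    split_ifs <;> ring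
  · ring

/-! ### Labelled unicyclic graphs -/

/-- A unicyclic graph on `0, …, n - 1` that contains the cycle `0, …, g - 1` and the path
`g - 1, …, m`; the remaining vertices `j > m` are attached to arbitrary parents `P j`. -/
structure HasLollipopCore {n : ℕ} (G : SimpleGraph (Fin n)) (g m : ℕ) (P : Fin n → Fin n)
    (h : Fin n → ℕ) : Prop where
  three_le : 3 ≤ g
  le_core : g ≤ m + 1
  core_lt : m < n
  isTreePlusEdge : ∀ r t : Fin n, (r : ℕ) = 0 → (t : ℕ) + 1 = g → IsTreePlusEdge G P h r t
  parent_val : ∀ j : Fin n, (j : ℕ) ≤ m → (P j : ℕ) = j - 1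

/-- The parent of a vertex in `graphU n k g`, seen as a tree with one additional edge. -/
def starParent (n k : ℕ) (j : Fin n) : Fin n := ⟨min (j - 1) (n - k - 1), by omega⟩

theorem graphU_hasLollipopCore {n k g : ℕ} (hg : 3 ≤ g) (hk : 1 ≤ k) (hn : g + k ≤ n) :
    HasLollipopCore (graphU n k g) g (n - k - 1) (starParent n k) (fun j => (j : ℕ)) where
  three_le := hg
  le_core := by omega
  core_lt := by omega
  isTreePlusEdge r t hr ht :=
    { height_lt := fun v hv => by
        simp only [starParent, ne_eq, Fin.ext_iff] at hv ⊢; omega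
      ne_root := by rw [ne_eq, Fin.ext_iff]; omega
      parent_ne_root := by simp only [starParent, ne_eq, Fin.ext_iff]; omega
      adj_iff := fun u v => by
        simp only [graphU, SimpleGraph.fromRel_adj, starParent, ne_eq, Fin.ext_iff]; omega }
  parent_val j hj := by simp only [starParent]; omega

/-- `graphU n k g` has a leaf, and a leaf is a test vector with Rayleigh quotient `1` that is not
an eigenvector. -/
theorem qMin_graphU_lt_one {n k g : ℕ} (hg : 3 ≤ g) (hk : 1 ≤ k) (hn : g + k ≤ n) :
    qMin (graphU n k g) < 1 := by
  have hU := graphU_hasLollipopCore hg hk hn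
  let r : Fin n := ⟨0, by omega⟩
  let t : Fin n := ⟨g - 1, by omega⟩
  let z : Fin n := ⟨n - 1, by omega⟩
  let c : Fin n := ⟨n - k - 1, by omega⟩
  have hT := hU.isTreePlusEdge r t rfl (by simp only [t]; omega)
  have hzr : z ≠ r := by simp only [z, r, ne_eq, Fin.ext_iff]; omega
  have hzt : z ≠ t := by simp only [z, t, ne_eq, Fin.ext_iff]; omega
  have hcz : c ≠ z := by simp only [c, z, ne_eq, Fin.ext_iff]; omega
  have hP : ∀ v, starParent n k v ≠ z := by
    intro v; simp only [starParent, z, ne_eq, Fin.ext_iff]; omega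
  have hPz : starParent n k z = c := by
    simp only [starParent, z, c, Fin.ext_iff]; omega
  have form : ∀ y : Fin n → ℝ, y ⬝ᵥ (signlessLaplacian (graphU n k g)).mulVec (Pi.single z 1) =
      y z + y c := by
    intro y
    rw [hT.dotProduct_mulVec, Finset.sum_eq_single z]
    · simp [hzr, hzr.symm, hzt.symm, hPz, hcz]
    · intro v _ hv
      simp [hv, hP v]
    · simp
  have h1 : qMin (graphU n k g) ≤ 1 := by
    refine qMin_le_of_dotProduct_le (x := Pi.single z 1) ?_ ?_
    · intro h0
      simpa using congrFun h0 z
    · rw [form]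
      simp [hcz]
  refine lt_of_le_of_ne h1 fun h2 => ?_
  have h3 := mulVec_eq_of_dotProduct_eq (graphU n k g) (Pi.single z 1) (by
    rw [form, h2]; simp [hcz])
  have h4 := form (Pi.single c 1)
  rw [h3] at h4
  simp [hcz.symm] at h4

/-! ### Moving all free vertices to the end of the path -/

/-- In an odd unicyclic graph an eigenvector that does not vanish on the core has a positive
eigenvalue: otherwise its entries would alternate along the odd cycle. -/
theorem HasLollipopCore.pos_of_mulVec_eq {n g m : ℕ} {G : SimpleGraph (Fin n)}
    {P : Fin n → Fin n} {h : Fin n → ℕ} (hG : HasLollipopCore G g m P h) (hodd : Odd g)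
    {x : Fin n → ℝ} {q : ℝ} (hx : (signlessLaplacian G).mulVec x = q • x)
    {c : Fin n} (hc : (c : ℕ) = m) (hxc : x c ≠ 0) : 0 < q := by
  have h3 := hG.three_le
  have hle := hG.le_core
  have hlt := hG.core_lt
  let r : Fin n := ⟨0, by omega⟩
  let t : Fin n := ⟨g - 1, by omega⟩
  have hT := hG.isTreePlusEdge r t rfl (by simp only [t]; omega)
  by_contra! hq
  have hform := hT.dotProduct_mulVec x x
  rw [hx, dotProduct_smul, smul_eq_mul] at hform
  have hD : 0 ≤ x ⬝ᵥ x := Finset.sum_nonneg fun i _ => mul_self_nonneg (x i)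
  have hN : ∀ v, 0 ≤ if v ≠ r then (x v + x (P v)) * (x v + x (P v)) else 0 := by
    intro v; split_ifs
    · exact mul_self_nonneg _
    · exact le_rfl
  have hS := Finset.sum_nonneg fun v (_ : v ∈ Finset.univ) => hN v
  have hE := mul_self_nonneg (x r + x t)
  have hqD : q * (x ⬝ᵥ x) ≤ 0 := mul_nonpos_of_nonpos_of_nonneg hq hD
  have hE0 : x r + x t = 0 := mul_self_eq_zero.1 (by linarith)
  have hS0 := (Finset.sum_eq_zero_iff_of_nonneg fun v _ => hN v).1 (by linarith :
    (∑ v, if v ≠ r then (x v + x (P v)) * (x v + x (P v)) else 0) = 0)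
  have halt : ∀ j (hj : j ≤ m), x ⟨j, by omega⟩ = (-1) ^ j * x r := by
    intro j
    induction j with
    | zero => intro _; simp [r]
    | succ j ih =>
      intro hj
      have h4 := hS0 ⟨j + 1, by omega⟩ (Finset.mem_univ _)
      have h5 : P ⟨j + 1, by omega⟩ = ⟨j, by omega⟩ := by
        rw [Fin.ext_iff, hG.parent_val _ hj]; simp
      rw [if_pos (by simp [r]), mul_self_eq_zero, h5, ih (by omega)] at h4
      rw [pow_succ]
      linarith
  have ht : x t = x r := by
    have := halt (g - 1) (by omega)
    rw [Even.neg_one_pow (by grind)] at this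
    simpa using this
  have hr : x r = 0 := by rw [ht] at hE0; linarith
  apply hxc
  have := halt m le_rfl
  rw [hr, mul_zero] at this
  rw [← this]
  congr 1
  exact Fin.ext hc

/-- The test vector on `graphU n k g` obtained from `x` by keeping the core `0, …, m` and giving
each other vertex the value that minimizes the contribution of a leaf at `m`, with signs
alternating along the path. -/
noncomputable def testVector (n k m : ℕ) (q a : ℝ) (x : Fin n → ℝ) (j : Fin n) : ℝ :=
  if (j : ℕ) ≤ m then x j else (-1) ^ (min (j : ℕ) (n - k) - m) * (a / (1 - q))

theorem testVector_add_parent {n k m : ℕ} (hkn : k < n) (hm : m ≤ n - k - 1) {q : ℝ}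
    {x : Fin n → ℝ} {c j : Fin n}
    (hc : (c : ℕ) = m) (hj : m < j) :
    testVector n k m q (x c) x j + testVector n k m q (x c) x (starParent n k j) =
      if (starParent n k j : ℕ) = m then x c - x c / (1 - q) else 0 := by
  have hjn := j.isLt
  unfold testVector
  rw [if_neg (by omega)]
  by_cases h : (starParent n k j : ℕ) = m
  · have h1 : starParent n k j = c := Fin.ext (by omega)
    have h2 : min (j : ℕ) (n - k) - m = 1 := by simp only [starParent] at h; omega
    rw [if_pos h.le, if_pos h, h1, h2]
    ring
  · have h2 : min (j : ℕ) (n - k) - m = min ((starParent n k j : Fin n) : ℕ) (n - k) - m + 1 := by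
      simp only [starParent] at h ⊢; omega
    rw [if_neg (by simp only [starParent] at h ⊢; omega), if_neg h, h2, pow_succ]
    ring

theorem neg_one_pow_mul_mul_self (i : ℕ) (b : ℝ) :
    (-1) ^ i * b * ((-1) ^ i * b) = b * b := by
  rcases neg_one_pow_eq_or ℝ i with h | h <;> rw [h] <;> ring

/-- The contribution of the vertex `j` to `x ⬝ (Q - q) x`, for a unicyclic graph in which `j` has
the parent `P j`. -/
noncomputable def vertexTerm {n : ℕ} (r : Fin n) (P : Fin n → Fin n) (q : ℝ) (x : Fin n → ℝ)
    (j : Fin n) : ℝ :=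
  (if j ≠ r then (x j + x (P j)) * (x j + x (P j)) else 0) - q * (x j * x j)

theorem IsTreePlusEdge.sum_vertexTerm {n : ℕ} {G : SimpleGraph (Fin n)} {P : Fin n → Fin n}
    {h : Fin n → ℕ} {r t : Fin n} (hG : IsTreePlusEdge G P h r t) (q : ℝ) (x : Fin n → ℝ) :
    (∑ j, vertexTerm r P q x j) + (x r + x t) * (x r + x t) =
      x ⬝ᵥ (signlessLaplacian G).mulVec x - q * (x ⬝ᵥ x) := by
  rw [hG.dotProduct_mulVec]
  simp only [vertexTerm, Finset.sum_sub_distrib, ← Finset.mul_sum, dotProduct]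
  ring

/-- Completing the square in the contribution of a vertex. -/
theorem vertexTerm_eq {n : ℕ} {r : Fin n} {P : Fin n → Fin n} {q : ℝ} {x : Fin n → ℝ} {j : Fin n}
    (hj : j ≠ r) (hq : q < 1) : vertexTerm r P q x j =
      (1 - q) * (x j + x (P j) / (1 - q)) ^ 2 - q / (1 - q) * x (P j) ^ 2 := by
  have : 1 - q ≠ 0 := by linarith
  rw [vertexTerm, if_pos hj]
  field_simp
  ring

section Comparison

variable {n k g m : ℕ} {G : SimpleGraph (Fin n)} {P : Fin n → Fin n} {h : Fin n → ℕ}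
  {x : Fin n → ℝ} {q : ℝ} {c r : Fin n}

theorem vertexTerm_testVector_of_le (hG : HasLollipopCore G g m P h) (hm : m ≤ n - k - 1)
    {a : ℝ} {j : Fin n} (hj : (j : ℕ) ≤ m) :
    vertexTerm r (starParent n k) q (testVector n k m q a x) j = vertexTerm r P q x j := by
  have h1 : starParent n k j = P j := by
    rw [Fin.ext_iff, hG.parent_val j hj]; simp only [starParent]; omega
  have h2 : (P j : ℕ) ≤ m := by rw [hG.parent_val j hj]; omega
  simp only [vertexTerm, testVector, h1, if_pos hj, if_pos h2]

theorem vertexTerm_testVector_of_lt (hkn : k < n) (hm : m ≤ n - k - 1)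
    (hc : (c : ℕ) = m) (hr : (r : ℕ) = 0) (hq1 : q < 1) {j : Fin n} (hj : m < j) :
    vertexTerm r (starParent n k) q (testVector n k m q (x c) x) j =
      -(q / (1 - q) * x c ^ 2) -
        if (starParent n k j : ℕ) = m then 0 else q ^ 2 * (x c / (1 - q)) ^ 2 := by
  have hjr : j ≠ r := by rw [ne_eq, Fin.ext_iff]; omega
  have hq0 : 1 - q ≠ 0 := by linarith
  rw [vertexTerm, if_pos hjr, testVector_add_parent hkn hm hc hj, testVector, if_neg (not_le.2 hj),
    neg_one_pow_mul_mul_self]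
  split_ifs <;> field_simp <;> ring

theorem vertexTerm_ge (hr : (r : ℕ) = 0) (hq0 : 0 < q) (hq1 : q < 1) {j : Fin n} (hj : m < j)
    (hP : |x (P j)| ≤ |x c|) : -(q / (1 - q) * x c ^ 2) ≤ vertexTerm r P q x j := by
  have hjr : j ≠ r := by rw [ne_eq, Fin.ext_iff]; omega
  have h1 : 0 < 1 - q := by linarith
  rw [vertexTerm_eq hjr hq1]
  have h2 := mul_le_mul_of_nonneg_left (sq_le_sq.2 hP) (div_pos hq0 h1).le
  have h3 := mul_nonneg h1.le (sq_nonneg (x j + x (P j) / (1 - q)))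
  linarith

theorem vertexTerm_testVector_le (hG : HasLollipopCore G g m P h) (hkn : k < n)
    (hm : m ≤ n - k - 1) (hc : (c : ℕ) = m) (hr : (r : ℕ) = 0) (hq0 : 0 < q) (hq1 : q < 1)
    (hP : ∀ j : Fin n, m < j → |x (P j)| ≤ |x c|) (j : Fin n) :
    vertexTerm r (starParent n k) q (testVector n k m q (x c) x) j ≤ vertexTerm r P q x j := by
  rcases le_or_gt (j : ℕ) m with hj | hj
  · exact (vertexTerm_testVector_of_le hG hm hj).le
  · rw [vertexTerm_testVector_of_lt hkn hm hc hr hq1 hj]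
    have h1 := vertexTerm_ge hr hq0 hq1 hj (hP j hj)
    have h2 : 0 ≤ if (starParent n k j : ℕ) = m then 0 else q ^ 2 * (x c / (1 - q)) ^ 2 := by
      split_ifs <;> positivity
    linarith

theorem dotProduct_testVector_le (hG : HasLollipopCore G g m P h) (hk : 1 ≤ k)
    (hn : g + k ≤ n) (hm : m ≤ n - k - 1) (hc : (c : ℕ) = m) (hq0 : 0 < q) (hq1 : q < 1)
    (hP : ∀ j : Fin n, m < j → |x (P j)| ≤ |x c|)
    (hx : (signlessLaplacian G).mulVec x = q • x) :
    testVector n k m q (x c) x ⬝ᵥ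
        (signlessLaplacian (graphU n k g)).mulVec (testVector n k m q (x c) x) ≤
      q * (testVector n k m q (x c) x ⬝ᵥ testVector n k m q (x c) x) := by
  have h3 := hG.three_le
  have hle := hG.le_core
  let r : Fin n := ⟨0, by omega⟩
  let t : Fin n := ⟨g - 1, by omega⟩
  have hT := hG.isTreePlusEdge r t rfl (by simp only [t]; omega)
  have hU := (graphU_hasLollipopCore h3 hk hn).isTreePlusEdge r t rfl (by simp only [t]; omega)
  have e1 := hT.sum_vertexTerm q x
  have e2 := hU.sum_vertexTerm q (testVector n k m q (x c) x)
  have e3 := Finset.sum_le_sum fun j (_ : j ∈ Finset.univ) =>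
    vertexTerm_testVector_le (r := r) hG (by omega : k < n) hm hc rfl hq0 hq1 hP j
  have e4 : testVector n k m q (x c) x r = x r := if_pos (Nat.zero_le _)
  have e5 : testVector n k m q (x c) x t = x t := if_pos (by simp only [t]; omega)
  rw [hx, dotProduct_smul, smul_eq_mul, sub_self] at e1
  rw [e4, e5] at e2
  linarith

/-- If the test vector is not better than `x`, then the core already reaches the centre of the
star, and each free vertex of `G` behaves like a leaf at a vertex of maximum modulus. -/
theorem eq_of_dotProduct_testVector_ge (hG : HasLollipopCore G g m P h) (hk : 1 ≤ k)
    (hn : g + k ≤ n) (hm : m ≤ n - k - 1) (hc : (c : ℕ) = m) (hq0 : 0 < q) (hq1 : q < 1)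
    (hxc : x c ≠ 0) (hP : ∀ j : Fin n, m < j → |x (P j)| ≤ |x c|)
    (hx : (signlessLaplacian G).mulVec x = q • x)
    (hge : q * (testVector n k m q (x c) x ⬝ᵥ testVector n k m q (x c) x) ≤
      testVector n k m q (x c) x ⬝ᵥ
        (signlessLaplacian (graphU n k g)).mulVec (testVector n k m q (x c) x)) :
    m = n - k - 1 ∧ ∀ j : Fin n, m < j → x j = -(x (P j) / (1 - q)) ∧ |x (P j)| = |x c| := by
  have h3 := hG.three_le
  have hle := hG.le_core
  let r : Fin n := ⟨0, by omega⟩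
  let t : Fin n := ⟨g - 1, by omega⟩
  have hT := hG.isTreePlusEdge r t rfl (by simp only [t]; omega)
  have hU := (graphU_hasLollipopCore h3 hk hn).isTreePlusEdge r t rfl (by simp only [t]; omega)
  have e1 := hT.sum_vertexTerm q x
  have e2 := hU.sum_vertexTerm q (testVector n k m q (x c) x)
  have hle' := vertexTerm_testVector_le (r := r) hG (by omega : k < n) hm hc rfl hq0 hq1 hP
  have e3 := Finset.sum_le_sum fun j (_ : j ∈ Finset.univ) => hle' j
  have e4 : testVector n k m q (x c) x r = x r := if_pos (Nat.zero_le _)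
  have e5 : testVector n k m q (x c) x t = x t := if_pos (by simp only [t]; omega)
  rw [hx, dotProduct_smul, smul_eq_mul, sub_self] at e1
  rw [e4, e5] at e2
  have hterm := (Finset.sum_eq_sum_iff_of_le fun j (_ : j ∈ Finset.univ) => hle' j).1
    (le_antisymm e3 (by linarith))
  have h1 : 0 < 1 - q := by linarith
  have hpos : 0 < q ^ 2 * (x c / (1 - q)) ^ 2 := by positivity
  have hstar : ∀ j : Fin n, m < j → (starParent n k j : ℕ) = m := by
    intro j hj
    by_contra hne
    have h4 := hterm j (Finset.mem_univ _)
    rw [vertexTerm_testVector_of_lt (by omega) hm hc rfl hq1 hj, if_neg hne] at h4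
    have h5 := vertexTerm_ge (r := r) rfl hq0 hq1 hj (hP j hj)
    linarith
  refine ⟨?_, fun j hj => ?_⟩
  · -- otherwise the first leaf of the star would have to hang at `m`
    by_contra hne
    have := hstar ⟨n - k, by omega⟩ (by simp only; omega)
    simp only [starParent] at this
    omega
  · have hjr : j ≠ r := by simp only [r, ne_eq, Fin.ext_iff]; omega
    have h4 := hterm j (Finset.mem_univ _)
    rw [vertexTerm_testVector_of_lt (by omega) hm hc rfl hq1 hj, if_pos (hstar j hj),
      vertexTerm_eq hjr hq1, sub_zero] at h4
    have h5 := mul_le_mul_of_nonneg_left (sq_le_sq.2 (hP j hj)) (div_pos hq0 h1).le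
    have h6 := mul_nonneg h1.le (sq_nonneg (x j + x (P j) / (1 - q)))
    have h7 : (1 - q) * (x j + x (P j) / (1 - q)) ^ 2 = 0 := by linarith
    have h8 : q / (1 - q) * x (P j) ^ 2 = q / (1 - q) * x c ^ 2 := by linarith
    have h9 : x j + x (P j) / (1 - q) = 0 := by
      rcases mul_eq_zero.1 h7 with h | h
      · linarith
      · exact pow_eq_zero_iff (two_ne_zero) |>.1 h
    exact ⟨by linarith, (sq_eq_sq_iff_abs_eq_abs _ _).1
      (mul_left_cancel₀ (div_pos hq0 h1).ne' h8)⟩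

/-- In the case of equality all free vertices hang at the end of the core: at any other vertex of
the core, the eigenvalue equations of `x` in `G` and of the test vector in `graphU n k g` differ by
the nonzero contributions of the free vertices. -/
theorem parent_eq_of_qMin_eq (hG : HasLollipopCore G g m P h) (hk : 1 ≤ k)
    (hn : g + k ≤ n) (hm : m = n - k - 1) (hc : (c : ℕ) = m) (hq0 : 0 < q) (hq1 : q < 1)
    (hxc : x c ≠ 0)
    (hj : ∀ j : Fin n, m < j → x j = -(x (P j) / (1 - q)) ∧ |x (P j)| = |x c|)
    (hx : (signlessLaplacian G).mulVec x = q • x)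
    (hy : (signlessLaplacian (graphU n k g)).mulVec (testVector n k m q (x c) x) =
      q • testVector n k m q (x c) x) (j : Fin n) (hmj : m < j) : P j = c := by
  have h3 := hG.three_le
  have hle := hG.le_core
  let r : Fin n := ⟨0, by omega⟩
  let t : Fin n := ⟨g - 1, by omega⟩
  have hT := hG.isTreePlusEdge r t rfl (by simp only [t]; omega)
  have hU := (graphU_hasLollipopCore h3 hk hn).isTreePlusEdge r t rfl (by simp only [t]; omega)
  have h1 : 0 < 1 - q := by linarith
  have hvm : (P j : ℕ) ≤ m := by
    -- the parent of a free vertex is too small in modulus to be free itself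
    by_contra! hlt
    obtain ⟨h4, h5⟩ := hj _ hlt
    have h6 : |x (P j)| = |x c| / (1 - q) := by
      rw [h4, abs_neg, abs_div, h5, abs_of_pos h1]
    rw [(hj j hmj).2, eq_div_iff h1.ne'] at h6
    have := abs_pos.2 hxc
    nlinarith
  by_contra hne
  set v := P j with hv
  have hvm' : (v : ℕ) < m := lt_of_le_of_ne hvm fun h' => hne (Fin.ext (h'.trans hc.symm))
  set y := testVector n k m q (x c) x with hydef
  have hyx : ∀ i : Fin n, (i : ℕ) ≤ m → y i = x i := fun i hi => if_pos hi
  have f1 := hT.dotProduct_mulVec (Pi.single v 1) x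
  have f2 := hU.dotProduct_mulVec (Pi.single v 1) y
  rw [hx, single_dotProduct, one_mul, Pi.smul_apply, smul_eq_mul] at f1
  rw [hy, single_dotProduct, one_mul, Pi.smul_apply, smul_eq_mul, hyx v hvm,
    hyx r (Nat.zero_le _), hyx t (by simp only [t]; omega)] at f2
  have f3 := f1.symm.trans f2
  have f4 : ∑ i : Fin n, ((if i ≠ r then ((Pi.single v 1 : Fin n → ℝ) i +
      (Pi.single v 1 : Fin n → ℝ) (P i)) * (x i + x (P i)) else 0) -
      (if i ≠ r then ((Pi.single v 1 : Fin n → ℝ) i +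
      (Pi.single v 1 : Fin n → ℝ) (starParent n k i)) * (y i + y (starParent n k i)) else 0)) =
      0 := by
    rw [Finset.sum_sub_distrib]; linarith
  have f5 : ∑ i : Fin n, (if m < (i : ℕ) ∧ P i = v then x v * (-q / (1 - q)) else 0) = 0 := by
    refine Eq.trans (Finset.sum_congr rfl fun i _ => ?_) f4
    rcases le_or_gt (i : ℕ) m with hi | hi
    · have h4 : starParent n k i = P i := by
        rw [Fin.ext_iff, hG.parent_val i hi]; simp only [starParent]; omega
      rw [h4, hyx i hi, hyx (P i) (by rw [hG.parent_val i hi]; omega), if_neg (by omega),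
        sub_self]
    · have hir : i ≠ r := by simp only [r, ne_eq, Fin.ext_iff]; omega
      have hiv : i ≠ v := by rw [ne_eq, Fin.ext_iff]; omega
      have hs : starParent n k i ≠ v := by
        rw [ne_eq, Fin.ext_iff]; simp only [starParent]; omega
      rw [if_pos hir, if_pos hir, Pi.single_eq_of_ne hiv, Pi.single_eq_of_ne hs]
      by_cases hPi : P i = v
      · rw [if_pos ⟨hi, hPi⟩, hPi, Pi.single_eq_same, (hj i hi).1, hPi]
        field_simp
        ring
      · rw [if_neg (fun h' => hPi h'.2), Pi.single_eq_of_ne hPi]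
        ring
  rw [← Finset.sum_filter, Finset.sum_const, nsmul_eq_mul, mul_eq_zero, mul_eq_zero] at f5
  have hxv : x v ≠ 0 := by
    rw [← abs_pos, (hj j hmj).2, abs_pos]; exact hxc
  rcases f5 with h' | h' | h'
  · rw [Nat.cast_eq_zero, Finset.card_eq_zero] at h'
    have : j ∈ (∅ : Finset (Fin n)) := by
      rw [← h', Finset.mem_filter]; exact ⟨Finset.mem_univ _, hmj, rfl⟩
    simp at this
  · exact hxv h'
  · rw [div_eq_zero_iff] at h'
    rcases h' with h' | h' <;> linarith

/-- A labelled odd unicyclic graph whose core ends at a vertex of maximum modulus among all parents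
of free vertices, for an eigenvector of the least eigenvalue, has at least the least eigenvalue of
`graphU n k g`, provided the core is not longer than that of `graphU n k g`. -/
theorem HasLollipopCore.qMin_graphU_le (hG : HasLollipopCore G g m P h) (hodd : Odd g)
    (hk : 1 ≤ k) (hn : g + k ≤ n) (hm : m ≤ n - k - 1) (hc : (c : ℕ) = m) (hxc : x c ≠ 0)
    (hP : ∀ j : Fin n, m < j → |x (P j)| ≤ |x c|)
    (hx : (signlessLaplacian G).mulVec x = qMin G • x) :
    qMin (graphU n k g) ≤ qMin G ∧ (qMin G = qMin (graphU n k g) → G = graphU n k g) := by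
  have h3 := hG.three_le
  have hle := hG.le_core
  have hlt := qMin_graphU_lt_one h3 hk hn
  rcases le_or_gt 1 (qMin G) with hq1 | hq1
  · exact ⟨by linarith, fun h' => by linarith⟩
  have hq0 := hG.pos_of_mulVec_eq hodd hx hc hxc
  have hle1 := dotProduct_testVector_le hG hk hn hm hc hq0 hq1 hP hx
  have hy0 : testVector n k m (qMin G) (x c) x ≠ 0 := fun h' => by
    have h4 := congrFun h' c
    rw [testVector, if_pos hc.le] at h4
    exact hxc h4
  refine ⟨qMin_le_of_dotProduct_le hy0 hle1, fun heq => ?_⟩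
  have hge1 := qMin_mul_dotProduct_le (graphU n k g) (testVector n k m (qMin G) (x c) x)
  rw [← heq] at hge1
  obtain ⟨hm', hj⟩ := eq_of_dotProduct_testVector_ge hG hk hn hm hc hq0 hq1 hxc hP hx hge1
  have hy := mulVec_eq_of_dotProduct_eq (graphU n k g) (testVector n k m (qMin G) (x c) x) (by
    rw [← heq]; exact le_antisymm hle1 hge1)
  rw [← heq] at hy
  have hpar := parent_eq_of_qMin_eq hG hk hn hm' hc hq0 hq1 hxc hj hx hy
  have hPeq : P = starParent n k := by
    ext j
    rcases le_or_gt (j : ℕ) m with hjm | hjm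
    · rw [hG.parent_val j hjm]; simp only [starParent]; omega
    · rw [hpar j hjm]; simp only [starParent]; omega
  have hT := hG.isTreePlusEdge ⟨0, by omega⟩ ⟨g - 1, by omega⟩ rfl (by simp only; omega)
  have hU := (graphU_hasLollipopCore h3 hk hn).isTreePlusEdge ⟨0, by omega⟩ ⟨g - 1, by omega⟩ rfl
    (by simp only; omega)
  ext u v
  rw [hT.adj_iff, hU.adj_iff, hPeq]

end Comparison

/-! ### Domination numbers -/

theorem dominationNumber_le_card {V : Type*} {G : SimpleGraph V} {S : Finset V}
    (hS : IsDominatingSet G S) : dominationNumber G ≤ S.card :=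
  Nat.sInf_le ⟨S, hS, rfl⟩

theorem exists_isDominatingSet_card_eq {V : Type*} [Fintype V] (G : SimpleGraph V) :
    ∃ S, IsDominatingSet G S ∧ S.card = dominationNumber G :=
  Nat.sInf_mem (s := {m : ℕ | ∃ S : Finset V, IsDominatingSet G S ∧ S.card = m})
    ⟨_, Finset.univ, fun v hv => absurd (Finset.mem_univ v) hv, rfl⟩

theorem dominationNumber_le_of_iso {V W : Type*} [Fintype V] {G : SimpleGraph V}
    {H : SimpleGraph W} (f : G ≃g H) : dominationNumber H ≤ dominationNumber G := by
  obtain ⟨S, hS, hcard⟩ := exists_isDominatingSet_card_eq G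
  rw [← hcard, ← Finset.card_map f.toEquiv.toEmbedding]
  refine dominationNumber_le_card fun v hv => ?_
  obtain ⟨u, hu, huv⟩ := hS (f.symm v) fun h => hv (Finset.mem_map.2 ⟨_, h, by simp⟩)
  refine ⟨f u, Finset.mem_map.2 ⟨u, hu, rfl⟩, ?_⟩
  rw [← f.map_rel_iff] at huv
  simpa using huv

theorem graphU_adj {n k g : ℕ} {i j : Fin n} : (graphU n k g).Adj i j ↔ (i : ℕ) ≠ j ∧
    ((((j : ℕ) = i + 1 ∧ (j : ℕ) + k < n) ∨ ((i : ℕ) = 0 ∧ (j : ℕ) + 1 = g) ∨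
      ((i : ℕ) + k + 1 = n ∧ n ≤ (j : ℕ) + k)) ∨
    (((i : ℕ) = j + 1 ∧ (i : ℕ) + k < n) ∨ ((j : ℕ) = 0 ∧ (i : ℕ) + 1 = g) ∨
      ((j : ℕ) + k + 1 = n ∧ n ≤ (i : ℕ) + k))) := by
  simp only [graphU, SimpleGraph.fromRel_adj, ne_eq, Fin.ext_iff]

theorem graphU_adj_succ {n k g i : ℕ} (hi : i + 1 + k < n) :
    (graphU n k g).Adj ⟨i, by omega⟩ ⟨i + 1, by omega⟩ :=
  graphU_adj.2 ⟨by simp, Or.inl (Or.inl ⟨rfl, hi⟩)⟩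

/-- Replacing all elements of a dominating set beyond the centre of the star by the new centre. -/
theorem dominationNumber_graphU_le_succ {n k g : ℕ} (hg : 3 ≤ g) (hk : 1 ≤ k)
    (hn : g + (k + 1) ≤ n) :
    dominationNumber (graphU n k g) ≤ dominationNumber (graphU n (k + 1) g) + 1 := by
  obtain ⟨S, hS, hcard⟩ := exists_isDominatingSet_card_eq (graphU n (k + 1) g)
  let c : Fin n := ⟨n - k - 1, by omega⟩
  have hc : (c : ℕ) = n - k - 1 := rfl
  let T := S.filter fun v : Fin n => (v : ℕ) + k + 1 < n
  have hT : ∀ v, v ∈ T ↔ v ∈ S ∧ (v : ℕ) + k + 1 < n := fun v => Finset.mem_filter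
  have hTS : T.card ≤ S.card := Finset.card_filter_le _ _
  have hins := Finset.card_insert_le c T
  refine (dominationNumber_le_card (S := insert c T) fun v hv => ?_).trans (by omega)
  rw [Finset.mem_insert, not_or, hT, not_and] at hv
  obtain ⟨hvc, hvS⟩ := hv
  by_cases h1 : n ≤ (v : ℕ) + k + 2
  · refine ⟨c, Finset.mem_insert_self _ _, graphU_adj.2 ?_⟩
    rw [Fin.ext_iff] at hvc
    omega
  · obtain ⟨u, hu, huv⟩ := hS v fun h => hvS h (by omega)
    rw [graphU_adj] at huv
    refine ⟨u, Finset.mem_insert_of_mem ((hT u).2 ⟨hu, by omega⟩), graphU_adj.2 ?_⟩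
    omega

/-- On a cycle with pendant vertices at one vertex, every third vertex of the cycle is enough. -/
theorem dominationNumber_graphU_sub_le {n g : ℕ} (hg : 3 ≤ g) (hgn : g < n) :
    dominationNumber (graphU n (n - g) g) ≤ ⌈(g : ℚ) / 3⌉₊ := by
  have hceil : (g + 2) / 3 ≤ ⌈(g : ℚ) / 3⌉₊ := by
    have h1 := Nat.le_ceil ((g : ℚ) / 3)
    rw [div_le_iff₀ (by norm_num)] at h1
    have h2 : g ≤ ⌈(g : ℚ) / 3⌉₊ * 3 := by exact_mod_cast h1
    omega
  refine le_trans ?_ hceil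
  let f : ℕ → Fin n := fun i => ⟨g - 1 - 3 * i, by omega⟩
  refine (dominationNumber_le_card (S := (Finset.range ((g + 2) / 3)).image f)
    fun v hv => ?_).trans (Finset.card_image_le.trans (by simp))
  have hmem : ∀ u : Fin n, (u : ℕ) < g → (g - 1 - u) % 3 = 0 →
      u ∈ (Finset.range ((g + 2) / 3)).image f := by
    intro u hu h3
    refine Finset.mem_image.2 ⟨(g - 1 - u) / 3, Finset.mem_range.2 (by omega), Fin.ext ?_⟩
    simp only [f]
    omega
  have hv' : ¬ ((v : ℕ) < g ∧ (g - 1 - v) % 3 = 0) := fun h => hv (hmem v h.1 h.2)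
  by_cases h1 : g ≤ (v : ℕ) ∨ (v : ℕ) = 0
  · refine ⟨⟨g - 1, by omega⟩, hmem _ (by simp only; omega) (by simp), graphU_adj.2 ?_⟩
    simp only
    omega
  · by_cases h2 : (g - 1 - v) % 3 = 1
    · refine ⟨⟨v + 1, by omega⟩, hmem _ (by simp only; omega) (by simp only; omega),
        graphU_adj_succ (by omega)⟩
    · refine ⟨⟨v - 1, by omega⟩, hmem _ (by simp only; omega) (by simp only; omega),
        graphU_adj.2 ?_⟩
      simp only
      omega

/-- A discrete intermediate value theorem: `k ↦ γ(U_n^k(g))` drops by at most one per step. -/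
theorem exists_dominationNumber_graphU_eq {n g γ k : ℕ} (hg : 3 ≤ g) (hk : 1 ≤ k)
    (hn : g + k ≤ n) (hγk : dominationNumber (graphU n k g) ≤ γ) (hγ : γ ≤ gammaMax n g) :
    ∃ j ∈ leafCounts n g γ, j ≤ k := by
  induction k, hk using Nat.le_induction with
  | base => exact ⟨1, ⟨le_rfl, hn, le_antisymm hγk hγ⟩, le_rfl⟩
  | succ k hk ih =>
    have h1 := dominationNumber_graphU_le_succ hg hk hn
    rcases hγk.lt_or_eq with h2 | h2
    · obtain ⟨j, hj, hjk⟩ := ih (by omega) (by omega)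
      exact ⟨j, hj, by omega⟩
    · exact ⟨k + 1, ⟨by omega, hn, h2⟩, le_rfl⟩

/-- If the core ends at the neighbour of a leaf, then projecting a dominating set along the trees
to the core yields a dominating set of the graph in which all free vertices hang at the end of the
core. -/
theorem HasLollipopCore.dominationNumber_graphU_le {n g m k : ℕ} {G : SimpleGraph (Fin n)}
    {P : Fin n → Fin n} {h : Fin n → ℕ} (hG : HasLollipopCore G g m P h) {w : Fin n}
    (hmk : m + k + 1 = n) (hk : 1 ≤ k) (hw : m < w) (hPw : (P w : ℕ) = m)
    (hleaf : ∀ j : Fin n, (j : ℕ) ≠ 0 → P j ≠ w) :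
    dominationNumber (graphU n k g) ≤ dominationNumber G := by
  have h3 := hG.three_le
  have hle := hG.le_core
  let r : Fin n := ⟨0, by omega⟩
  let t : Fin n := ⟨g - 1, by omega⟩
  have hT := hG.isTreePlusEdge r t rfl (by simp only [t]; omega)
  obtain ⟨S, hS, hcard⟩ := exists_isDominatingSet_card_eq G
  let s : Fin n → Fin n := fun z => if (z : ℕ) ≤ m then z else P z
  have hs1 : ∀ z : Fin n, (z : ℕ) ≤ m → s z = z := fun z hz => if_pos hz
  have hs2 : ∀ z : Fin n, m < (z : ℕ) → s z = P z := fun z hz => if_neg (by omega)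
  have hfix : ∀ N (z : Fin n), (z : ℕ) ≤ m → s^[N] z = z :=
    fun N z hz => Function.iterate_fixed (hs1 z hz) N
  have hcore : ∀ N (z : Fin n), h z ≤ N → (s^[N] z : ℕ) ≤ m := by
    intro N
    induction N with
    | zero =>
      intro z hz
      by_contra! hlt
      have := hT.height_lt z (by simp only [r, ne_eq, Fin.ext_iff]; simp at hlt; omega)
      omega
    | succ N ih =>
      intro z hz
      rw [Function.iterate_succ_apply]
      rcases le_or_gt (z : ℕ) m with hzm | hzm
      · rw [hs1 z hzm, hfix N z hzm]; exact hzm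
      · rw [hs2 z hzm]
        have := hT.height_lt z (by simp only [r, ne_eq, Fin.ext_iff]; omega)
        exact ih _ (by omega)
  let N := Finset.univ.sup h
  have hφ : ∀ z, (s^[N] z : ℕ) ≤ m := fun z => hcore N z (Finset.le_sup (Finset.mem_univ z))
  have hφP : ∀ z : Fin n, m < (z : ℕ) → s^[N] (P z) = s^[N] z := by
    intro z hz
    rw [← hs2 z hz, ← Function.iterate_succ_apply, Function.iterate_succ_apply',
      hs1 _ (hφ z)]
  have hmem : ∀ u ∈ S, s^[N] u ∈ S.image s^[N] := fun u hu => Finset.mem_image_of_mem _ hu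
  rw [← hcard]
  refine (dominationNumber_le_card (S := S.image s^[N]) fun v hv => ?_).trans
    Finset.card_image_le
  rcases le_or_gt (v : ℕ) m with hvm | hvm
  · have hvS : v ∉ S := fun h' => hv (by simpa only [hfix N v hvm] using hmem v h')
    obtain ⟨u, hu, huv⟩ := hS v hvS
    have huv' := (hT.adj_iff v u).1 huv
    rcases le_or_gt (u : ℕ) m with hum | hum
    · refine ⟨u, by simpa only [hfix N u hum] using hmem u hu, graphU_adj.2 ?_⟩
      have e1 := hG.parent_val u hum
      have e2 := hG.parent_val v hvm
      simp only [r, t, ne_eq, Fin.ext_iff] at huv'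
      omega
    · exfalso
      have e2 := hG.parent_val v hvm
      rcases huv' with h' | h' | h' | h'
      · rw [Fin.ext_iff] at h'; omega
      · apply hv
        have := hmem u hu
        rwa [← hφP u hum, h'.2, hfix N v hvm] at this
      · simp only [r, t, Fin.ext_iff] at h'; omega
      · simp only [r, t, Fin.ext_iff] at h'; omega
  · refine ⟨P w, ?_, graphU_adj.2 (by omega)⟩
    by_cases hwS : w ∈ S
    · have := hmem w hwS
      rwa [← hφP w hw, hfix N (P w) hPw.le] at this
    · obtain ⟨u, hu, huw⟩ := hS w hwS
      rcases (hT.adj_iff w u).1 huw with h' | h' | h' | h'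
      · have := hmem u hu
        rwa [← h'.2, hfix N (P w) hPw.le] at this
      · exact absurd h'.2 (hleaf u fun h0 => h'.1 (Fin.ext h0))
      · simp only [r, t, Fin.ext_iff] at h'; omega
      · simp only [r, t, Fin.ext_iff] at h'; omega

/-! ### The graph `U_n^k(g)` is unicyclic of girth `g` -/

section GraphU

variable {n k g : ℕ}

theorem graphU_reachable_zero (hg : 3 ≤ g) (hk : 1 ≤ k) (hn : g + k ≤ n) (r : Fin n)
    (hr : (r : ℕ) = 0) (v : Fin n) : (graphU n k g).Reachable r v := by
  have hT := (graphU_hasLollipopCore hg hk hn).isTreePlusEdge r ⟨g - 1, by omega⟩ hr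
    (by simp only; omega)
  induction v using WellFoundedLT.induction with
  | ind v ih =>
    by_cases hv : v = r
    · rw [hv]
    · exact (ih _ (hT.height_lt v hv)).trans
        ((hT.adj_iff _ _).2 (Or.inr (Or.inl ⟨hv, rfl⟩))).reachable

theorem graphU_connected (hg : 3 ≤ g) (hk : 1 ≤ k) (hn : g + k ≤ n) :
    (graphU n k g).Connected := by
  have hr := graphU_reachable_zero hg hk hn ⟨0, by omega⟩ rfl
  exact (SimpleGraph.connected_iff_exists_forall_reachable _).2 ⟨_, hr⟩

theorem graphU_exists_isCycle (hg : 3 ≤ g) (hk : 1 ≤ k) (hn : g + k ≤ n) :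
    ∃ (v : Fin n) (c : (graphU n k g).Walk v v), c.IsCycle := by
  have h1 : ∀ j (hj : j < g), ((graphU n k g).deleteEdges
      {s((⟨0, by omega⟩ : Fin n), ⟨g - 1, by omega⟩)}).Reachable ⟨0, by omega⟩ ⟨j, by omega⟩ := by
    intro j
    induction j with
    | zero => intro _; exact SimpleGraph.Reachable.refl _
    | succ j ih =>
      intro hj
      refine (ih (by omega)).trans (SimpleGraph.Adj.reachable ?_)
      rw [SimpleGraph.deleteEdges_adj]
      refine ⟨graphU_adj_succ (by omega), ?_⟩
      simp only [Set.mem_singleton_iff, Sym2.eq_iff, Fin.mk.injEq]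
      omega
  obtain ⟨u, p, hp, -⟩ := SimpleGraph.adj_and_reachable_delete_edges_iff_exists_cycle.1
    ⟨graphU_adj.2 ⟨by simp only; omega, by simp only [true_and]; omega⟩, h1 (g - 1) (by omega)⟩
  exact ⟨u, p, hp⟩

/-- The largest vertex of a cycle has two smaller neighbours, which is only possible for
`g - 1`. -/
theorem graphU_lt_of_mem_cycle {u : Fin n}
    {c : (graphU n k g).Walk u u} (hc : c.IsCycle) {v : Fin n} (hv : v ∈ c.support) :
    (v : ℕ) < g := by
  obtain ⟨w, hw, hmax⟩ := c.support.toFinset.exists_max_image id ⟨v, by simpa using hv⟩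
  rw [List.mem_toFinset] at hw
  have hvw : v ≤ w := hmax v (by simpa using hv)
  obtain ⟨a, b, hab, hN⟩ := Set.ncard_eq_two.1 (hc.ncard_neighborSet_toSubgraph_eq_two hw)
  have key : ∀ z ∈ c.toSubgraph.neighborSet w, z ≤ w ∧ (graphU n k g).Adj w z := fun z hz =>
    ⟨hmax z (by rw [List.mem_toFinset, ← c.mem_verts_toSubgraph]; exact hz.snd_mem), hz.adj_sub⟩
  have ha := key a (by rw [hN]; simp)
  have hb := key b (by rw [hN]; simp)
  rw [graphU_adj, Fin.le_def] at ha hb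
  rw [ne_eq, Fin.ext_iff] at hab
  rw [Fin.le_def] at hvw
  omega

theorem graphU_toSubgraph_neighborSet (hg : 3 ≤ g) (hk : 1 ≤ k) (hn : g + k ≤ n) {u : Fin n}
    {c : (graphU n k g).Walk u u} (hc : c.IsCycle) {v : Fin n} (hv : v ∈ c.support) :
    c.toSubgraph.neighborSet v = {w : Fin n | (w : ℕ) < g ∧ (graphU n k g).Adj v w} := by
  have hvg := graphU_lt_of_mem_cycle hc hv
  refine Set.eq_of_subset_of_ncard_le (fun w hw => ⟨graphU_lt_of_mem_cycle hc ?_,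
    hw.adj_sub⟩) ?_ (Set.toFinite _)
  · rw [← c.mem_verts_toSubgraph]; exact hw.snd_mem
  · rw [hc.ncard_neighborSet_toSubgraph_eq_two hv]
    let a : Fin n := ⟨if (v : ℕ) = 0 then g - 1 else v - 1, by split_ifs <;> omega⟩
    let b : Fin n := ⟨if (v : ℕ) + 1 = g then 0 else v + 1, by split_ifs <;> omega⟩
    refine (Set.ncard_le_ncard (t := {a, b}) ?_ (Set.toFinite _)).trans (
      (Set.ncard_insert_le a {b}).trans (by simp))
    rintro w ⟨hw, hvw⟩
    rw [graphU_adj] at hvw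
    simp only [Set.mem_insert_iff, Set.mem_singleton_iff, a, b, Fin.ext_iff]
    split_ifs <;> omega

theorem graphU_mem_cycle_iff (hg : 3 ≤ g) (hk : 1 ≤ k) (hn : g + k ≤ n) {u : Fin n}
    {c : (graphU n k g).Walk u u} (hc : c.IsCycle) {v : Fin n} :
    v ∈ c.support ↔ (v : ℕ) < g := by
  refine ⟨graphU_lt_of_mem_cycle hc, ?_⟩
  have step : ∀ a b : Fin n, a ∈ c.support → (b : ℕ) < g → (graphU n k g).Adj a b →
      b ∈ c.support := by
    intro a b ha hb hab
    have h1 : b ∈ c.toSubgraph.neighborSet a := by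
      rw [graphU_toSubgraph_neighborSet hg hk hn hc ha]; exact ⟨hb, hab⟩
    rw [← c.mem_verts_toSubgraph]
    exact h1.snd_mem
  have hdown : ∀ i (hi : i < n), ⟨i, hi⟩ ∈ c.support → (⟨0, by omega⟩ : Fin n) ∈ c.support := by
    intro i
    induction i with
    | zero => intro _ h; exact h
    | succ i ih =>
      intro hi h
      have := graphU_lt_of_mem_cycle hc h
      simp only at this
      exact ih (by omega) (step _ _ h (by simp only; omega) (graphU_adj_succ (by omega)).symm)
  have h0 := hdown u u.isLt c.start_mem_support
  have hup : ∀ i (hi : i < g), (⟨i, by omega⟩ : Fin n) ∈ c.support := by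
    intro i
    induction i with
    | zero => intro _; exact h0
    | succ i ih =>
      intro hi
      exact step _ _ (ih (by omega)) hi (graphU_adj_succ (by omega))
  exact hup v

theorem SimpleGraph.Walk.IsCycle.card_support_toFinset {V : Type*} [DecidableEq V]
    {G : SimpleGraph V} {u : V} {c : G.Walk u u} (hc : c.IsCycle) :
    c.support.toFinset.card = c.length := by
  have h1 : c.support.toFinset = c.support.tail.toFinset := by
    ext v
    rw [List.mem_toFinset, List.mem_toFinset, c.mem_support_iff]
    refine ⟨?_, Or.inr⟩
    rintro (rfl | h)
    · exact SimpleGraph.Walk.end_mem_tail_support hc.not_nil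
    · exact h
  rw [h1, List.toFinset_card_of_nodup hc.support_nodup, List.length_tail, c.length_support]
  simp

theorem graphU_cycle_length (hg : 3 ≤ g) (hk : 1 ≤ k) (hn : g + k ≤ n) {u : Fin n}
    {c : (graphU n k g).Walk u u} (hc : c.IsCycle) : c.length = g := by
  have h1 : c.support.toFinset = Finset.univ.filter fun v : Fin n => (v : ℕ) < g := by
    ext v
    simp [graphU_mem_cycle_iff hg hk hn hc]
  rw [← hc.card_support_toFinset, h1, Fin.card_filter_val_lt]
  omega

theorem graphU_isUnicyclic (hg : 3 ≤ g) (hk : 1 ≤ k) (hn : g + k ≤ n) :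
    IsUnicyclic (graphU n k g) := by
  refine ⟨graphU_connected hg hk hn, ?_⟩
  obtain ⟨u, c, hc⟩ := graphU_exists_isCycle hg hk hn
  refine ⟨c.toSubgraph, ⟨u, c, hc, rfl⟩, ?_⟩
  rintro _ ⟨u', c', hc', rfl⟩
  have hsupp : ∀ v, v ∈ c'.support ↔ v ∈ c.support := fun v => by
    rw [graphU_mem_cycle_iff hg hk hn hc, graphU_mem_cycle_iff hg hk hn hc']
  refine SimpleGraph.Subgraph.ext (Set.ext fun v => ?_) (funext fun v => funext fun w => ?_)
  · rw [SimpleGraph.Walk.mem_verts_toSubgraph, SimpleGraph.Walk.mem_verts_toSubgraph, hsupp]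
  · have h1 : ∀ {x : Fin n} {d : (graphU n k g).Walk x x}, d.IsCycle →
        (d.toSubgraph.Adj v w ↔
          (v : ℕ) < g ∧ (w : ℕ) < g ∧ (graphU n k g).Adj v w) := by
      intro x d hd
      rw [← graphU_mem_cycle_iff hg hk hn hd, ← d.mem_verts_toSubgraph]
      refine ⟨fun h => ⟨h.fst_mem, ?_⟩, fun h => ?_⟩
      · have := graphU_toSubgraph_neighborSet hg hk hn hd (d.mem_verts_toSubgraph.1 h.fst_mem)
        exact this.le h
      · have := graphU_toSubgraph_neighborSet hg hk hn hd (d.mem_verts_toSubgraph.1 h.1)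
        exact this.ge h.2
    exact propext ((h1 hc').trans (h1 hc).symm)

theorem graphU_girth (hg : 3 ≤ g) (hk : 1 ≤ k) (hn : g + k ≤ n) : (graphU n k g).girth = g := by
  obtain ⟨u, c, hc⟩ := graphU_exists_isCycle hg hk hn
  obtain ⟨v, d, hd, h⟩ := SimpleGraph.exists_girth_eq_length.2 fun h => h c hc
  rw [h, graphU_cycle_length hg hk hn hd]

end GraphU

/-! ### The structure of unicyclic graphs -/

section Structure

variable {V : Type*} {G : SimpleGraph V}

theorem IsUnicyclic.card_edgeSet [Fintype V] (hG : IsUnicyclic G) :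
    G.edgeSet.ncard = Fintype.card V := by
  classical
  obtain ⟨hconn, H, ⟨v, c, hc, rfl⟩, huniq⟩ := hG
  obtain ⟨e, he⟩ : ∃ e, e ∈ c.edges := List.exists_mem_of_ne_nil _ fun h => by
    have h1 := hc.three_le_length
    rw [← c.length_edges, h] at h1
    simp at h1
  induction e with
  | _ x y =>
  have heG : s(x, y) ∈ G.edgeSet := c.edges_subset_edgeSet he
  have hbr : ¬ G.IsBridge s(x, y) := fun h => h.notMem_edges_of_isCycle hc he
  have hle : G.deleteEdges {s(x, y)} ≤ G := SimpleGraph.deleteEdges_le _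
  have htree : (G.deleteEdges {s(x, y)}).IsTree := by
    refine ⟨hconn.connected_delete_edge_of_not_isBridge hbr, fun u d hd => ?_⟩
    -- a cycle avoiding the deleted edge would be a second cycle of `G`
    have h1 := huniq _ ⟨u, d.mapLe hle, hd.mapLe hle, rfl⟩
    have h2 : s(x, y) ∈ (d.mapLe hle).edges := by
      rw [← SimpleGraph.Walk.mem_edges_toSubgraph, h1, SimpleGraph.Walk.mem_edges_toSubgraph]
      exact he
    rw [SimpleGraph.Walk.edges_mapLe_eq_edges] at h2
    have h3 := d.edges_subset_edgeSet h2
    rw [SimpleGraph.edgeSet_deleteEdges] at h3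
    exact h3.2 rfl
  have hcard := htree.card_edgeFinset
  rw [← Set.ncard_coe_finset, SimpleGraph.coe_edgeFinset, SimpleGraph.edgeSet_deleteEdges,
    Set.ncard_sdiff_singleton_of_mem heG] at hcard
  have : 0 < G.edgeSet.ncard := (Set.ncard_pos (Set.toFinite _)).2 ⟨_, heG⟩
  omega

/-- In a connected graph, the distance `dep` to a nonempty set of vertices, and for each vertex
outside the set a neighbour `par` that is nearer. -/
theorem exists_dist_parent (hG : G.Connected) {s : Set V} (hs : s.Nonempty) :
    ∃ (dep : V → ℕ) (par : V → V), (∀ z, dep z = 0 ↔ z ∈ s) ∧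
      ∀ z, dep z ≠ 0 → dep (par z) + 1 = dep z ∧ G.Adj z (par z) := by
  classical
  have hex : ∀ z, ∃ d, ∃ w ∈ s, ∃ p : G.Walk z w, p.length = d := fun z => by
    obtain ⟨w, hw⟩ := hs
    obtain ⟨p⟩ := hG z w
    exact ⟨_, w, hw, p, rfl⟩
  have h0 : ∀ z, Nat.find (hex z) = 0 ↔ z ∈ s := by
    intro z
    rw [Nat.find_eq_zero]
    constructor
    · rintro ⟨w, hw, p, hp⟩
      rwa [SimpleGraph.Walk.eq_of_length_eq_zero hp]
    · intro hz
      exact ⟨z, hz, SimpleGraph.Walk.nil, rfl⟩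
  have hpar : ∀ z, ∃ y, Nat.find (hex z) ≠ 0 →
      Nat.find (hex y) + 1 = Nat.find (hex z) ∧ G.Adj z y := by
    intro z
    obtain ⟨w, hw, p, hp⟩ := Nat.find_spec (hex z)
    cases p with
    | nil => exact ⟨z, fun h => absurd hp.symm h⟩
    | @cons _ y _ hzy p =>
      refine ⟨y, fun _ => ⟨?_, hzy⟩⟩
      have h1 : Nat.find (hex y) ≤ p.length := Nat.find_min' _ ⟨w, hw, p, rfl⟩
      obtain ⟨w', hw', p', hp'⟩ := Nat.find_spec (hex y)
      have h2 : Nat.find (hex z) ≤ p'.length + 1 :=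
        Nat.find_min' _ ⟨w', hw', SimpleGraph.Walk.cons hzy p', by simp⟩
      rw [SimpleGraph.Walk.length_cons] at hp
      omega
  choose par hpar using hpar
  exact ⟨_, par, h0, hpar⟩

/-- The graph `G` consists of the cycle `c` and trees attached to it: `dep` is the distance to the
cycle and `par` the next vertex on the way to the cycle. -/
structure IsCycleWithTrees (G : SimpleGraph V) {v : V} (c : G.Walk v v) (dep : V → ℕ)
    (par : V → V) : Prop where
  isCycle : c.IsCycle
  dep_eq_zero_iff : ∀ z, dep z = 0 ↔ z ∈ c.support
  dep_par : ∀ z, dep z ≠ 0 → dep (par z) + 1 = dep z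
  adj_iff : ∀ u w, G.Adj u w ↔
    s(u, w) ∈ c.edges ∨ (dep u ≠ 0 ∧ par u = w) ∨ (dep w ≠ 0 ∧ par w = u)

/-- The edges of the cycle and the edges to the parents are `n` different edges, so they are all
edges of a unicyclic graph of order `n`. -/
theorem IsUnicyclic.exists_isCycleWithTrees [Fintype V] (hG : IsUnicyclic G) {v : V}
    {c : G.Walk v v} (hc : c.IsCycle) :
    ∃ (dep : V → ℕ) (par : V → V), IsCycleWithTrees G c dep par := by
  classical
  obtain ⟨dep, par, h0, hpar⟩ := exists_dist_parent hG.1 (s := {z | z ∈ c.support})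
    ⟨v, c.start_mem_support⟩
  refine ⟨dep, par, hc, h0, fun z hz => (hpar z hz).1, ?_⟩
  let T : Finset V := Finset.univ.filter fun z => dep z ≠ 0
  let E : Finset (Sym2 V) := c.edges.toFinset ∪ T.image fun z => s(z, par z)
  have hE : (E : Set (Sym2 V)) ⊆ G.edgeSet := by
    intro e he
    simp only [E, T, Finset.coe_union, Finset.coe_image, Set.mem_union, List.coe_toFinset,
      Finset.coe_filter, Set.mem_image] at he
    rcases he with he | ⟨z, hz, rfl⟩
    · exact c.edges_subset_edgeSet he
    · exact (hpar z hz.2).2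
  have hcardE : E.card = Fintype.card V := by
    have h1 : Disjoint c.edges.toFinset (T.image fun z => s(z, par z)) := by
      rw [Finset.disjoint_left]
      intro e he he'
      obtain ⟨z, hz, rfl⟩ := Finset.mem_image.1 he'
      rw [List.mem_toFinset] at he
      exact (Finset.mem_filter.1 hz).2 ((h0 z).2 (c.fst_mem_support_of_mem_edges he))
    have h2 : Set.InjOn (fun z => s(z, par z)) (T : Set V) := by
      intro a ha b hb hab
      have ha' := hpar a (Finset.mem_filter.1 ha).2
      have hb' := hpar b (Finset.mem_filter.1 hb).2
      rcases Sym2.eq_iff.1 hab with h | h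
      · exact h.1
      · exfalso
        rw [h.2] at ha'
        rw [← h.1] at hb'
        omega
    have h3 : T.card + c.support.toFinset.card = Fintype.card V := by
      have h4 : c.support.toFinset = Finset.univ.filter fun z => ¬ dep z ≠ 0 := by
        ext z
        simp [h0]
      rw [h4]
      exact Finset.card_filter_add_card_filter_not _
    rw [Finset.card_union_of_disjoint h1, Finset.card_image_of_injOn h2,
      List.toFinset_card_of_nodup hc.edges_nodup, c.length_edges, ← hc.card_support_toFinset]
    omega
  have hEeq : (E : Set (Sym2 V)) = G.edgeSet :=
    Set.eq_of_subset_of_ncard_le hE (by rw [hG.card_edgeSet, Set.ncard_coe_finset, hcardE])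
      (Set.toFinite _)
  intro u w
  rw [← SimpleGraph.mem_edgeSet, ← hEeq]
  simp only [E, T, Finset.coe_union, Finset.coe_image, Set.mem_union, List.coe_toFinset,
    Finset.coe_filter, Set.mem_image, Finset.mem_univ, true_and, Set.mem_ofPred_eq, Sym2.eq_iff]
  refine or_congr Iff.rfl ⟨?_, ?_⟩
  · rintro ⟨z, hz, ⟨rfl, rfl⟩ | ⟨rfl, rfl⟩⟩
    · exact Or.inl ⟨hz, rfl⟩
    · exact Or.inr ⟨hz, rfl⟩
  · rintro (⟨hz, rfl⟩ | ⟨hz, rfl⟩)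
    · exact ⟨u, hz, Or.inl ⟨rfl, rfl⟩⟩
    · exact ⟨w, hz, Or.inr ⟨rfl, rfl⟩⟩

theorem IsCycleWithTrees.rotate [DecidableEq V] {v : V} {c : G.Walk v v} {dep : V → ℕ}
    {par : V → V} (h : IsCycleWithTrees G c dep par) {u : V} (hu : u ∈ c.support) :
    IsCycleWithTrees G (c.rotate u hu) dep par where
  isCycle := h.isCycle.rotate hu
  dep_eq_zero_iff z := by rw [h.dep_eq_zero_iff, SimpleGraph.Walk.mem_support_rotate_iff]
  dep_par := h.dep_par
  adj_iff a b := by rw [h.adj_iff, (c.rotate_edges u hu).mem_iff]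

theorem IsCycleWithTrees.dep_iterate_par {v : V} {c : G.Walk v v} {dep : V → ℕ}
    {par : V → V} (h : IsCycleWithTrees G c dep par) (w : V) {i : ℕ} (hi : i ≤ dep w) :
    dep (par^[i] w) = dep w - i := by
  induction i with
  | zero => rfl
  | succ i ih =>
    have h1 := ih (by omega)
    have h2 := h.dep_par (par^[i] w) (by omega)
    rw [Function.iterate_succ_apply']
    omega

end Structure

/-! ### Labelling a unicyclic graph along a path from the cycle -/

section Labelling

variable {V : Type*} {G : SimpleGraph V}

theorem SimpleGraph.Walk.mem_edges_iff_getVert {u v a b : V} (p : G.Walk u v) :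
    s(a, b) ∈ p.edges ↔ ∃ i < p.length, s(p.getVert i, p.getVert (i + 1)) = s(a, b) := by
  rw [← SimpleGraph.Walk.adj_toSubgraph_iff_mem_edges, SimpleGraph.Walk.toSubgraph_adj_iff]
  exact ⟨fun ⟨i, h1, h2⟩ => ⟨i, h2, h1⟩, fun ⟨i, h1, h2⟩ => ⟨i, h2, h1⟩⟩

/-- The cycle `0, …, g - 1`, starting after the base point of `c`, and the path from the base point
to `w`, with `w` at `g - 1 + dep w`. -/
def coreLabel {v : V} (c : G.Walk v v) (dep : V → ℕ) (par : V → V) (w : V) (j : ℕ) : V :=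
  if j < c.length then c.getVert (j + 1) else par^[dep w + c.length - 1 - j] w

theorem IsCycleWithTrees.dep_coreLabel {v : V} {c : G.Walk v v} {dep : V → ℕ} {par : V → V}
    (h : IsCycleWithTrees G c dep par) (w : V) {j : ℕ} (hj : j + 1 ≤ c.length + dep w) :
    dep (coreLabel c dep par w j) = j + 1 - c.length := by
  unfold coreLabel
  split_ifs with h1
  · rw [(h.dep_eq_zero_iff _).2 (c.getVert_mem_support _)]; omega
  · rw [h.dep_iterate_par w (by omega)]; omega

theorem IsCycleWithTrees.coreLabel_injOn {v : V} {c : G.Walk v v} {dep : V → ℕ} {par : V → V}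
    (h : IsCycleWithTrees G c dep par) (w : V) :
    Set.InjOn (coreLabel c dep par w) {j | j + 1 ≤ c.length + dep w} := by
  intro i hi j hj hij
  rw [Set.mem_ofPred_eq] at hi hj
  have h1 := congrArg dep hij
  rw [h.dep_coreLabel w hi, h.dep_coreLabel w hj] at h1
  rcases lt_or_ge i c.length with hic | hic
  · have hjc : j < c.length := by omega
    rw [coreLabel, coreLabel, if_pos hic, if_pos hjc] at hij
    have := h.isCycle.getVert_injOn (by rw [Set.mem_ofPred_eq]; omega)
      (by rw [Set.mem_ofPred_eq]; omega) hij
    omega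
  · omega

theorem exists_equiv_fin_extend [Fintype V] {n m : ℕ} (hn : Fintype.card V = n) {f : ℕ → V}
    (hf : Set.InjOn f {j | j < m}) : ∃ σ : Fin n ≃ V, ∀ j : Fin n, (j : ℕ) < m → σ j = f j := by
  classical
  obtain ⟨σ, hσ⟩ := Set.MapsTo.exists_equiv_extend_of_card_eq (α := Fin n) (t := Finset.univ)
    (s := {j : Fin n | (j : ℕ) < m}) (f := fun j => f j) (by rw [Fintype.card_fin, ← hn]; rfl)
    (fun _ _ => by simp) (fun i hi j hj hij => Fin.ext (hf hi hj hij))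
  exact ⟨σ.trans (Equiv.subtypeUnivEquiv Finset.mem_univ), fun j hj => hσ j hj⟩

/-- A unicyclic graph can be labelled by `0, …, n - 1` in such a way that the core consists of the
cycle and the path from the cycle to a given vertex `w`. -/
theorem IsCycleWithTrees.exists_labelling [Fintype V] {v : V} {c : G.Walk v v} {dep : V → ℕ}
    {par : V → V} (hc : IsCycleWithTrees G c dep par) {n g : ℕ} (hn : Fintype.card V = n)
    (hg : c.length = g) (w : V) :
    ∃ (σ : Fin n ≃ V) (P : Fin n → Fin n) (h : Fin n → ℕ),
      HasLollipopCore (G.comap σ) g (g - 1 + dep w) P h ∧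
      (∀ j : Fin n, (j : ℕ) = g - 1 + dep w → σ j = w) ∧
      (∀ j : Fin n, (j : ℕ) < g → dep (σ j) = 0) ∧
      ∀ j : Fin n, g ≤ (j : ℕ) → dep (σ j) ≠ 0 ∧ σ (P j) = par (σ j) := by
  classical
  subst hg
  wlog hv : par^[dep w] w = v generalizing v
  · have hu : par^[dep w] w ∈ c.support := by
      rw [← hc.dep_eq_zero_iff, hc.dep_iterate_par w le_rfl, Nat.sub_self]
    have := this (hc.rotate hu) rfl
    rwa [c.length_rotate] at this
  have h3 := hc.isCycle.three_le_length
  set g := c.length with hgdef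
  set f := coreLabel c dep par w with hf
  have hinj : Set.InjOn f {j | j < g + dep w} := hc.coreLabel_injOn w
  obtain ⟨σ, hσ⟩ := exists_equiv_fin_extend hn hinj
  have hfg : ∀ j, j < g → f j = c.getVert (j + 1) := fun j hj => if_pos hj
  have hfg1 : f (g - 1) = v := by
    rw [hfg _ (by omega), Nat.sub_add_cancel (by omega), c.getVert_length]
  have hfpath : ∀ j, g - 1 ≤ j → f j = par^[dep w + g - 1 - j] w := by
    intro j hj
    rcases hj.eq_or_lt with rfl | hj
    · rw [hfg1, ← hv]; congr 2; omega
    · exact if_neg (by omega)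
  have hcard : g + dep w ≤ n := by
    have h4 : ((Finset.range (g + dep w)).image f).card = g + dep w := by
      rw [Finset.card_image_of_injOn, Finset.card_range]
      exact fun a ha b hb => hinj (by simpa using ha) (by simpa using hb)
    rw [← h4, ← hn]
    exact Finset.card_le_univ _
  have hdep0 : ∀ j : Fin n, (j : ℕ) < g → dep (σ j) = 0 := fun j hj => by
    rw [hσ j (by omega), hc.dep_coreLabel w (by omega)]; omega
  have hdep1 : ∀ j : Fin n, g ≤ (j : ℕ) → dep (σ j) ≠ 0 := fun j hj h0 => by
    rw [hc.dep_eq_zero_iff, SimpleGraph.Walk.mem_support_iff_exists_getVert] at h0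
    obtain ⟨i, hi, hig⟩ := h0
    obtain ⟨i', hi', hii⟩ : ∃ i', i' < g ∧ f i' = σ j := by
      rcases i with _ | i
      · exact ⟨g - 1, by omega, by rw [hfg1, ← hi, c.getVert_zero]⟩
      · exact ⟨i, by omega, by rw [hfg i (by omega), hi]⟩
    have h5 := hσ ⟨i', by omega⟩ (by simp only; omega)
    simp only at h5
    rw [hii] at h5
    have := congrArg Fin.val (σ.injective h5)
    simp only at this
    omega
  let P : Fin n → Fin n := fun j =>
    if (j : ℕ) < g then ⟨j - 1, by omega⟩ else σ.symm (par (σ j))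
  have hP0 : ∀ j : Fin n, (j : ℕ) < g → (P j : ℕ) = j - 1 := fun j hj => by
    simp only [P, if_pos hj]
  have hP1 : ∀ j : Fin n, g ≤ (j : ℕ) → σ (P j) = par (σ j) := fun j hj => by
    simp only [P, if_neg (not_lt.2 hj), Equiv.apply_symm_apply]
  let h : Fin n → ℕ := fun j => if (j : ℕ) < g then j else g + dep (σ j)
  have hh0 : ∀ j : Fin n, (j : ℕ) < g → h j = j := fun j hj => if_pos hj
  have hh1 : ∀ j : Fin n, g ≤ (j : ℕ) → h j = g + dep (σ j) := fun j hj => if_neg (not_lt.2 hj)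
  refine ⟨σ, P, h, ⟨h3, by omega, by omega, fun r t hr ht => ⟨fun u hu => ?_, ?_, ?_, fun a b => ?_⟩,
    fun j hj => ?_⟩, fun j hj => ?_, hdep0, fun j hj => ⟨hdep1 j hj, hP1 j hj⟩⟩
  · have hu0 : (u : ℕ) ≠ 0 := fun h' => hu (Fin.ext (h'.trans hr.symm))
    rcases lt_or_ge (u : ℕ) g with hug | hug
    · have := hP0 u hug
      rw [hh0 u hug, hh0 _ (by omega)]
      omega
    · have h4 := hc.dep_par _ (hdep1 u hug)
      rw [← hP1 u hug] at h4
      rw [hh1 u hug]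
      rcases lt_or_ge (P u : ℕ) g with hPg | hPg
      · rw [hh0 _ hPg]; omega
      · rw [hh1 _ hPg]; omega
  · rw [ne_eq, Fin.ext_iff]; omega
  · rw [ne_eq, Fin.ext_iff, hP0 t (by omega)]; omega
  · rw [SimpleGraph.comap_adj, hc.adj_iff, c.mem_edges_iff_getVert]
    have hσr : σ r = c.getVert 1 := by rw [hσ r (by omega), hr, hfg 0 (by omega)]
    have hσt : σ t = c.getVert 0 := by
      rw [hσ t (by omega), c.getVert_zero, ← hfg1]; congr 1; omega
    have hσj : ∀ j : Fin n, (j : ℕ) < g → σ j = c.getVert (j + 1) := fun j hj => by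
      rw [hσ j (by omega), hfg j hj]
    have hroot : ∀ j : Fin n, g ≤ (j : ℕ) → j ≠ r := fun j hj h' => by
      rw [h', hr] at hj; omega
    constructor
    · rintro (⟨i, hi, hiab⟩ | ⟨ha, hab⟩ | ⟨hb, hab⟩)
      · rcases i with _ | i
        · rw [zero_add, ← hσt, ← hσr, Sym2.eq_iff, σ.apply_eq_iff_eq, σ.apply_eq_iff_eq,
            σ.apply_eq_iff_eq, σ.apply_eq_iff_eq] at hiab
          rcases hiab with ⟨rfl, rfl⟩ | ⟨rfl, rfl⟩
          · exact Or.inr (Or.inr (Or.inr ⟨rfl, rfl⟩))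
          · exact Or.inr (Or.inr (Or.inl ⟨rfl, rfl⟩))
        · have e1 := hσj ⟨i, by omega⟩ (by simp only; omega)
          have e2 := hσj ⟨i + 1, by omega⟩ (by simp only; omega)
          simp only at e1 e2
          have e3 : P ⟨i + 1, by omega⟩ = ⟨i, by omega⟩ :=
            Fin.ext (by rw [hP0 _ (by simp only; omega)]; simp)
          have e4 : (⟨i + 1, by omega⟩ : Fin n) ≠ r := by
            rw [ne_eq, Fin.ext_iff, hr]; simp
          rw [← e1, ← e2, Sym2.eq_iff, σ.apply_eq_iff_eq, σ.apply_eq_iff_eq,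
            σ.apply_eq_iff_eq, σ.apply_eq_iff_eq] at hiab
          rcases hiab with ⟨rfl, rfl⟩ | ⟨rfl, rfl⟩
          · exact Or.inr (Or.inl ⟨e4, e3⟩)
          · exact Or.inl ⟨e4, e3⟩
      · have hag : g ≤ (a : ℕ) := by by_contra! h'; exact ha (hdep0 a h')
        exact Or.inl ⟨hroot a hag, σ.injective (by rw [hP1 a hag, hab])⟩
      · have hbg : g ≤ (b : ℕ) := by by_contra! h'; exact hb (hdep0 b h')
        exact Or.inr (Or.inl ⟨hroot b hbg, σ.injective (by rw [hP1 b hbg, hab])⟩)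
    · have hcyc : ∀ j : Fin n, (j : ℕ) < g → j ≠ r →
          ∃ i < g, s(c.getVert i, c.getVert (i + 1)) = s(σ (P j), σ j) := fun j hj hjr => by
        have e1 := hP0 j hj
        have e2 : (j : ℕ) ≠ 0 := fun h' => hjr (Fin.ext (h'.trans hr.symm))
        refine ⟨j, hj, ?_⟩
        rw [hσj j hj, hσj (P j) (by omega), e1, Nat.sub_add_cancel (by omega)]
      rintro (⟨ha, hab⟩ | ⟨hb, hab⟩ | ⟨rfl, rfl⟩ | ⟨rfl, rfl⟩)
      · rcases lt_or_ge (a : ℕ) g with hag | hag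
        · left
          rw [← hab, Sym2.eq_swap]
          exact hcyc a hag ha
        · exact Or.inr (Or.inl ⟨hdep1 a hag, by rw [← hP1 a hag, hab]⟩)
      · rcases lt_or_ge (b : ℕ) g with hbg | hbg
        · left
          rw [← hab]
          exact hcyc b hbg hb
        · exact Or.inr (Or.inr ⟨hdep1 b hbg, by rw [← hP1 b hbg, hab]⟩)
      · exact Or.inl ⟨0, by omega, by rw [zero_add, hσt, hσr, Sym2.eq_swap]⟩
      · exact Or.inl ⟨0, by omega, by rw [zero_add, hσt, hσr]⟩
  · rcases lt_or_ge (j : ℕ) g with hjg | hjg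
    · exact hP0 j hjg
    · have e1 : σ (P j) = σ ⟨j - 1, by omega⟩ := by
        rw [hP1 j hjg, hσ j (by omega), hσ _ (by simp only; omega), hfpath _ (by omega),
          hfpath _ (by simp only; omega), ← Function.iterate_succ_apply' par]
        simp only
        congr 2
        omega
      rw [σ.injective e1]
  · rw [hσ j (by omega), hj, hfpath _ (by omega)]
    have : dep w + g - 1 - (g - 1 + dep w) = 0 := by omega
    rw [this, Function.iterate_zero, id]

end Labelling

/-! ### Comparison within the class -/

/-- An eigenvector that vanishes at the ends of the additional edge and at all parents has the
eigenvalue `1`. -/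
theorem IsTreePlusEdge.eq_one_of_mulVec_eq {V : Type*} [Fintype V] [DecidableEq V]
    {G : SimpleGraph V} {P : V → V} {h : V → ℕ} {r t : V} (hG : IsTreePlusEdge G P h r t)
    {x : V → ℝ} {q : ℝ} (hx0 : x ≠ 0) (hx : (signlessLaplacian G).mulVec x = q • x)
    (hr : x r = 0) (ht : x t = 0) (hP : ∀ v, v ≠ r → x (P v) = 0) : q = 1 := by
  have h1 := hG.dotProduct_mulVec x x
  have h2 : (∑ v, if v ≠ r then (x v + x (P v)) * (x v + x (P v)) else 0) = x ⬝ᵥ x := by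
    refine Finset.sum_congr rfl fun v _ => ?_
    by_cases hv : v = r
    · simp [hv, hr]
    · rw [if_pos hv, hP v hv, add_zero]
  rw [hx, h2, hr, ht, dotProduct_smul, smul_eq_mul, add_zero, mul_zero, add_zero] at h1
  have h3 : x ⬝ᵥ x ≠ 0 := by rwa [ne_eq, dotProduct_self_eq_zero]
  exact mul_right_cancel₀ h3 (h1.trans (one_mul _).symm)

section Class

variable {V : Type*} [Fintype V] {G : SimpleGraph V} {v : V} {c : G.Walk v v} {dep : V → ℕ}
  {par : V → V} {n g k : ℕ}

/-- If the trees attached to the cycle of `G` have depth at most the distance from the cycle to the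
leaves of `graphU n k g`, then `G` has at least the least eigenvalue of `graphU n k g`, and equality
only holds for isomorphic graphs. -/
theorem IsCycleWithTrees.qMin_graphU_le (hc : IsCycleWithTrees G c dep par)
    (hn : Fintype.card V = n) (hg : c.length = g) (hodd : Odd g) (hk : 1 ≤ k) (hgk : g + k ≤ n)
    {D : ℕ} (hD : 1 ≤ D) (hdep : ∀ z, dep z ≤ D) (hDk : g + D + k ≤ n + 1) :
    qMin (graphU n k g) ≤ qMin G ∧
      (qMin G = qMin (graphU n k g) → Nonempty (G ≃g graphU n k g)) := by
  classical
  have h3 : 3 ≤ g := hg ▸ hc.isCycle.three_le_length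
  have : Nonempty V := ⟨v⟩
  have hlt := qMin_graphU_lt_one h3 hk hgk
  rcases le_or_gt 1 (qMin G) with hq1 | hq1
  · exact ⟨by linarith, fun h' => by linarith⟩
  obtain ⟨x, hx0, hx⟩ := exists_mulVec_eq_qMin_smul G
  -- `w` has maximum modulus among all vertices that can be parents; leaves at depth `D` may be larger
  obtain ⟨w, hw, hmax⟩ := (Finset.univ.filter fun z => dep z < D).exists_max_image
    (fun z => |x z|) ⟨v, by
      rw [Finset.mem_filter, (hc.dep_eq_zero_iff v).2 c.start_mem_support]
      exact ⟨Finset.mem_univ _, hD⟩⟩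
  have hwD : dep w < D := (Finset.mem_filter.1 hw).2
  have hmax' : ∀ z, dep z < D → |x z| ≤ |x w| := fun z hz =>
    hmax z (Finset.mem_filter.2 ⟨Finset.mem_univ _, hz⟩)
  obtain ⟨σ, P, h, hcore, hσw, hσ0, hσP⟩ := hc.exists_labelling hn hg w
  let f : G.comap σ ≃g G := SimpleGraph.Iso.comap σ G
  have hx' : (signlessLaplacian (G.comap σ)).mulVec (x ∘ σ) = qMin (G.comap σ) • (x ∘ σ) :=
    mulVec_comp_iso f hx
  have hle := hcore.le_core
  have hmn := hcore.core_lt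
  let r : Fin n := ⟨0, by omega⟩
  let t : Fin n := ⟨g - 1, by omega⟩
  let e : Fin n := ⟨g - 1 + dep w, hmn⟩
  have he : σ e = w := hσw e rfl
  have hT := hcore.isTreePlusEdge r t rfl (by simp only [t]; omega)
  have hparD : ∀ j, dep (σ (P j)) < D := by
    intro j
    rcases lt_or_ge (j : ℕ) g with hj | hj
    · have := hcore.parent_val j (by omega)
      rw [hσ0 (P j) (by omega)]
      exact hD
    · have h4 := hc.dep_par _ (hσP j hj).1
      have h5 := hdep (σ j)
      rw [(hσP j hj).2]
      omega
  have hxw : x w ≠ 0 := by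
    intro hxw
    have hzero : ∀ z, dep z < D → x z = 0 := fun z hz => by
      have := hmax' z hz
      rw [hxw, abs_zero] at this
      exact abs_nonpos_iff.1 this
    have h4 := hT.eq_one_of_mulVec_eq (comp_iso_ne_zero f hx0) hx'
      (hzero _ ((hσ0 r (by simp only [r]; omega)).trans_lt hD))
      (hzero _ ((hσ0 t (by simp only [t]; omega)).trans_lt hD))
      fun j _ => hzero _ (hparD j)
    rw [qMin_congr f] at h4
    linarith
  have hmain := hcore.qMin_graphU_le (c := e) hodd hk hgk (by omega) rfl
    (by rw [Function.comp_apply, he]; exact hxw)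
    (fun j _ => by
      rw [Function.comp_apply, Function.comp_apply, he]; exact hmax' _ (hparD j)) hx'
  rw [qMin_congr f] at hmain
  refine ⟨hmain.1, fun heq => ?_⟩
  rw [← hmain.2 heq]
  exact ⟨f.symm⟩

/-- The domination number bounds the depth `D` of the attached trees: `G` contains the cycle with a
pendant path of length `D`, onto which dominating sets can be projected. -/
theorem IsCycleWithTrees.dominationNumber_graphU_le (hc : IsCycleWithTrees G c dep par)
    (hn : Fintype.card V = n) (hg : c.length = g) {w : V} (hw : dep w ≠ 0)
    (hmax : ∀ z, dep z ≤ dep w) : ∃ k, 1 ≤ k ∧ g + dep w + k = n + 1 ∧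
      dominationNumber (graphU n k g) ≤ dominationNumber G := by
  have h3 : 3 ≤ g := hg ▸ hc.isCycle.three_le_length
  have hpw := hc.dep_par w hw
  obtain ⟨σ, P, h, hcore, hσw, hσ0, hσP⟩ := hc.exists_labelling hn hg (par w)
  have hle := hcore.le_core
  have hmn := hcore.core_lt
  obtain ⟨j, rfl⟩ := σ.surjective w
  have hjg : g ≤ (j : ℕ) := by by_contra! h'; exact hw (hσ0 j h')
  have hPj : P j = ⟨g - 1 + dep (par (σ j)), hmn⟩ :=
    σ.injective ((hσP j hjg).2.trans (hσw _ rfl).symm)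
  have hPj' : (P j : ℕ) = g - 1 + dep (par (σ j)) := by rw [hPj]
  have hjm : g - 1 + dep (par (σ j)) < (j : ℕ) := by
    by_contra! hlt
    have := hcore.parent_val j hlt
    omega
  refine ⟨n - (g - 1 + dep (par (σ j))) - 1, by omega, by omega, ?_⟩
  refine (hcore.dominationNumber_graphU_le (w := j) (by omega) (by omega) hjm hPj' ?_).trans
    (dominationNumber_le_of_iso (SimpleGraph.Iso.comap σ G).symm)
  rintro i hi rfl
  rcases lt_or_ge (i : ℕ) g with hig | hig
  · have := hcore.parent_val i (by omega)
    omega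
  · have h4 := hc.dep_par _ (hσP i hig).1
    rw [← (hσP i hig).2] at h4
    have := hmax (σ i)
    omega

theorem IsCycleWithTrees.exists_dep_ne_zero (hc : IsCycleWithTrees G c dep par)
    (hlt : c.length < Fintype.card V) : ∃ w, dep w ≠ 0 ∧ ∀ z, dep z ≤ dep w := by
  classical
  have : Nonempty V := ⟨v⟩
  obtain ⟨w, -, hw⟩ := Finset.univ.exists_max_image dep Finset.univ_nonempty
  refine ⟨w, fun h0 => ?_, fun z => hw z (Finset.mem_univ _)⟩
  have h1 : c.support.toFinset = Finset.univ := Finset.eq_univ_iff_forall.2 fun z => by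
    rw [List.mem_toFinset, ← hc.dep_eq_zero_iff]
    have := hw z (Finset.mem_univ _)
    omega
  rw [← hc.isCycle.card_support_toFinset, h1, Finset.card_univ] at hlt
  exact lt_irrefl _ hlt

end Class

/-! ### The extremal graph -/

theorem mainTheorem4 (n g γ : ℕ) (hg3 : 3 ≤ g) (hgodd : Odd g) (hgn : g < n)
    (hγl : ⌈(g : ℚ) / 3⌉₊ ≤ γ) (hγu : γ ≤ gammaMax n g) :
    (leafCounts n g γ).Nonempty ∧
    IsUnicyclicOfType n g γ (graphV n γ g) ∧
    ∀ (W : Type*) [Fintype W] (G : SimpleGraph W), IsUnicyclicOfType n g γ G →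
      qMin (graphV n γ g) ≤ qMin G ∧
      (qMin G = qMin (graphV n γ g) ↔ Nonempty (G ≃g graphV n γ g)) := by
  have hne : (leafCounts n g γ).Nonempty := by
    obtain ⟨j, hj, -⟩ := exists_dominationNumber_graphU_eq (k := n - g) hg3 (by omega) (by omega)
      ((dominationNumber_graphU_sub_le hg3 hgn).trans hγl) hγu
    exact ⟨j, hj⟩
  obtain ⟨hk, hgk, hγ⟩ := Nat.sInf_mem hne
  refine ⟨hne, ⟨Fintype.card_fin n, graphU_isUnicyclic hg3 hk hgk, ?_, graphU_girth hg3 hk hgk,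
    hγ⟩, ?_⟩
  · rw [graphV, graphU_girth hg3 hk hgk]; exact hgodd
  rintro W _ G ⟨hcard, huni, -, hgirth, hdom⟩
  obtain ⟨v₀, c₀, hc₀⟩ := huni.2.exists.choose_spec
  obtain ⟨v, c, hc, hlen⟩ := SimpleGraph.exists_girth_eq_length.2 fun h => h c₀ hc₀.1
  rw [hgirth] at hlen
  obtain ⟨dep, par, hG⟩ := huni.exists_isCycleWithTrees hc
  obtain ⟨w, hw, hmax⟩ := hG.exists_dep_ne_zero (by omega)
  obtain ⟨k, hk1, hwk, hγk⟩ := hG.dominationNumber_graphU_le hcard hlen.symm hw hmax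
  obtain ⟨j, hj, hjk⟩ := exists_dominationNumber_graphU_eq hg3 hk1 (by omega)
    (hγk.trans hdom.le) hγu
  -- so the trees of `G` are not deeper than those of the extremal graph
  have hinf : sInf (leafCounts n g γ) ≤ k := (Nat.sInf_le hj).trans hjk
  obtain ⟨h1, h2⟩ := hG.qMin_graphU_le hcard hlen.symm hgodd hk hgk (by omega) hmax (by omega)
  have : Nonempty (Fin n) := ⟨⟨0, by omega⟩⟩
  exact ⟨h1, h2, fun ⟨f⟩ => qMin_congr f⟩
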